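/- Fix one of the three categories of metrics: Riemannian, reversible Finsler, or (not necessarily reversible) Finsler. A Finsler metric on a surface $S$ is a continuous function $F:TS\to[0,\infty)$, smooth outside the zero section, whose restriction to each tangent space is a possibly asymmetric norm ($F(u+v)\le F(u)+F(v)$; $F(tu)=tF(u)$ for $t\ge 0$; $F(u)>0$ for $u\ne 0$); it is reversible if $F(-u)=F(u)$, and Riemannian if each restriction is the norm of an inner product. Areas are Holmes–Thompson areas (the symplectic volume of the unit co-disk bundle divided by $\pi$, which is the usual area for a Riemannian metric), and lengths are taken of piecewise smooth curves. Let $M$ be a closed connected surface, and write $\mathrm{sys}(M,F)\in(0,\infty]$ for the infimal length of the noncontractible loops of $(M,F)$. Suppose that $M$ carries a systolically extremal metric $F_0$ of the given category, that is, a metric of this category, possibly only continuous, such that $$\frac{\mathrm{sys}(M,F)}{\sqrt{\mathrm{area}(M,F)}}\;\le\; c(M):=\frac{\mathrm{sys}(M,F_0)}{\sqrt{\mathrm{area}(M,F_0)}}$$ for every smooth metric $F$ of this category on $M$. Let $k\ge 0$, let $x_1,\dots,x_k$ be distinct points of $M$, and let $\Sigma=M\setminus\{x_1,\dots,x_k\}$.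 Then every complete (in the non-reversible case: forward complete or backward complete) metric of the same category on $\Sigma$ satisfies $$\mathrm{sys}_*(\Sigma)\;\le\; c(M)\,\sqrt{\mathrm{area}(\Sigma)},$$ where $\mathrm{sys}_*(\Sigma)$ is the infimal length of the admissible loops of $\Sigma$, a loop of $\Sigma$ being admissible if it is not homotopic in $\Sigma$ to a point or to a multiple of a small circle around one of the punctures $x_i$. (Infima over the empty set are $+\infty$.) -/

import Mathlib

open Set Filter Topology MeasureTheory
open scoped Manifold ContDiff ENNReal

/-! Finsler and Riemannian metrics on open subsets of a surface, lengths, Holmes-Thompson area,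
systole and marked systole.

Throughout, `M` is a surface, modelled on `EuclideanSpace ℝ (Fin 2)`, and `U` is an open subset
of `M`: it is `univ` for the surface itself, and the complement of finitely many points for the
punctured surface.  A metric on `U` is a function on the tangent bundle of `M` of which only the
values over `U` matter. -/

noncomputable section

namespace SystolicSurface

/-- The Euclidean plane, on which surfaces are modelled. -/
abbrev Plane : Type := EuclideanSpace ℝ (Fin 2)

variable {M : Type*} [TopologicalSpace M] [ChartedSpace Plane M]

section Metrics

variable [IsManifold (𝓡 2) ∞ M]

/-- `F` is a continuous Finsler metric on `U`: a continuous function on the tangent bundle of `U`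
that restricts to a (possibly asymmetric) norm on each tangent space. -/
structure IsContinuousFinslerMetric (U : Set M) (F : TangentBundle (𝓡 2) M → ℝ) : Prop where
  continuousOn : ContinuousOn F {v | v.proj ∈ U}
  subadditive : ∀ x ∈ U, ∀ u v : TangentSpace (𝓡 2) x, F ⟨x, u + v⟩ ≤ F ⟨x, u⟩ + F ⟨x, v⟩
  homogeneous : ∀ x ∈ U, ∀ t : ℝ, 0 ≤ t → ∀ u : TangentSpace (𝓡 2) x, F ⟨x, t • u⟩ = t * F ⟨x, u⟩
  pos : ∀ x ∈ U, ∀ u : TangentSpace (𝓡 2) x, u ≠ 0 → 0 < F ⟨x, u⟩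

/-- `F` is a Finsler metric on `U`: moreover `F` is smooth outside the zero section. -/
structure IsFinslerMetric (U : Set M) (F : TangentBundle (𝓡 2) M → ℝ) : Prop
    extends IsContinuousFinslerMetric U F where
  contMDiffOn : ContMDiffOn (𝓡 2).tangent 𝓘(ℝ, ℝ) ∞ F {v | v.proj ∈ U ∧ v.snd ≠ 0}

/-- The three categories of metrics under consideration. -/
inductive MetricKind
  | riemannian
  | reversibleFinsler
  | finsler

/-- The condition that a category imposes on a (continuous) Finsler metric `F` on `U`.

* Riemannian: `F` is the norm of an inner product on each tangent space.  (The coefficients of the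
  inner product are obtained from `F ^ 2` on nonzero vectors by polarization, so they are smooth,
  respectively continuous, exactly when `F` is smooth outside the zero section,
  respectively continuous.)
* reversible Finsler: `F (-u) = F u`.
* Finsler: no condition. -/
def MetricKind.Holds : MetricKind → (U : Set M) → (F : TangentBundle (𝓡 2) M → ℝ) → Prop
  | .riemannian, U, F => ∀ x ∈ U, ∃ B : LinearMap.BilinForm ℝ (TangentSpace (𝓡 2) x),
      (∀ u v, B u v = B v u) ∧ ∀ u : TangentSpace (𝓡 2) x, F ⟨x, u⟩ ^ 2 = B u u
  | .reversibleFinsler, U, F => ∀ x ∈ U, ∀ u : TangentSpace (𝓡 2) x, F ⟨x, -u⟩ = F ⟨x, u⟩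
  | .finsler, _, _ => True

end Metrics

section Length

/-- The curve `γ`, considered on `[0, 1]`, is piecewise smooth (and continuous). -/
def PiecewiseSmooth (γ : ℝ → M) : Prop :=
  ContinuousOn γ (Icc 0 1) ∧
    ∃ (n : ℕ) (t : ℕ → ℝ), Monotone t ∧ t 0 = 0 ∧ t n = 1 ∧
      ∀ i < n, ContMDiffOn 𝓘(ℝ, ℝ) (𝓡 2) ∞ γ (Icc (t i) (t (i + 1)))

/-- The length `∫₀¹ F (γ' t) dt` of a curve with respect to `F`. -/
def length (F : TangentBundle (𝓡 2) M → ℝ) (γ : ℝ → M) : ℝ≥0∞ :=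
  ∫⁻ t in Icc (0 : ℝ) 1, ENNReal.ofReal (F ⟨γ t, mfderiv 𝓘(ℝ, ℝ) (𝓡 2) γ t (1 : ℝ)⟩)

/-- The (possibly asymmetric) distance from `x` to `y`: the infimal length of a piecewise smooth
curve of `U` from `x` to `y`. -/
def finslerDist (U : Set M) (F : TangentBundle (𝓡 2) M → ℝ) (x y : M) : ℝ≥0∞ :=
  ⨅ (γ : ℝ → M) (_ : PiecewiseSmooth γ ∧ MapsTo γ (Icc 0 1) U ∧ γ 0 = x ∧ γ 1 = y), length F γ

/-- Every forward Cauchy sequence of `U` converges in `U`. -/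
def IsForwardComplete (U : Set M) (F : TangentBundle (𝓡 2) M → ℝ) : Prop :=
  ∀ x : ℕ → M, (∀ n, x n ∈ U) →
    (∀ ε : ℝ≥0∞, 0 < ε → ∃ N, ∀ m n, N ≤ m → m ≤ n → finslerDist U F (x m) (x n) < ε) →
    ∃ y ∈ U, Tendsto x atTop (𝓝 y)

/-- Every backward Cauchy sequence of `U` converges in `U`. -/
def IsBackwardComplete (U : Set M) (F : TangentBundle (𝓡 2) M → ℝ) : Prop :=
  ∀ x : ℕ → M, (∀ n, x n ∈ U) →
    (∀ ε : ℝ≥0∞, 0 < ε → ∃ N, ∀ m n, N ≤ m → m ≤ n → finslerDist U F (x n) (x m) < ε) →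
    ∃ y ∈ U, Tendsto x atTop (𝓝 y)

end Length

section Area

/-- The Holmes-Thompson area density of `F` in the chart at `p`, at the point `y` of the target
of this chart: the Lebesgue area of the unit co-disk at that point (covectors of the plane being
written as vectors through the standard inner product), divided by the area `π` of the Euclidean
unit disk.  In canonical coordinates the symplectic volume is the Lebesgue measure, so integrating
this density amounts to taking the symplectic volume of the unit co-disk bundle over `π`. -/
def holmesThompsonDensity (F : TangentBundle (𝓡 2) M → ℝ) (p : M) (y : Plane) : ℝ≥0∞ :=
  volume {ξ : Plane | ∀ v : Plane,
      inner ℝ ξ v ≤ F ⟨(chartAt Plane p).symm y,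
        mfderiv (𝓡 2) (𝓡 2) (chartAt Plane p).symm y v⟩} /
    ENNReal.ofReal Real.pi

variable [MeasurableSpace M]

/-- The Holmes-Thompson area measure of `(U, F)` on the domain of the chart at `p`. -/
def chartArea (U : Set M) (F : TangentBundle (𝓡 2) M → ℝ) (p : M) : Measure M :=
  Measure.map (chartAt Plane p).symm
    ((volume.restrict ((chartAt Plane p).target ∩ (chartAt Plane p).symm ⁻¹' U)).withDensity
      (holmesThompsonDensity F p))

/-- The Holmes-Thompson area of `(U, F)`.  The area measures in the charts are the restrictions of
one measure to the chart domains, and this measure is their supremum.  For a Riemannian metric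
this is the Riemannian area. -/
def area (U : Set M) (F : TangentBundle (𝓡 2) M → ℝ) : ℝ≥0∞ :=
  (⨆ p : M, chartArea U F p) univ

end Area

section Loops

/-- The parametrization by `ℝ` of a loop. -/
def loopCurve {U : Set M} (γ : C(UnitAddCircle, U)) (t : ℝ) : M := (γ (t : UnitAddCircle) : M)

/-- The systole of `(U, F)`: the infimal length of the noncontractible (piecewise smooth) loops
of `U`; it is `∞` if there is none. -/
def systole (U : Set M) (F : TangentBundle (𝓡 2) M → ℝ) : ℝ≥0∞ :=
  ⨅ (γ : C(UnitAddCircle, U)) (_ : PiecewiseSmooth (loopCurve γ) ∧ ¬ γ.Nullhomotopic),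
    length F (loopCurve γ)

/-- `δ` is a multiple of a small circle around the point `x` of `P`: in the chart at `x`, it runs
`m` times (`m` any integer) around a circle centered at `x`, which bounds a closed disk contained
in the chart that meets `P` only at `x`. -/
def IsCuspLoopMultiple (P : Finset M) (x : M) (δ : C(UnitAddCircle, ((P : Set M)ᶜ : Set M))) :
    Prop :=
  ∃ (r : ℝ) (m : ℤ), 0 < r ∧
    Metric.closedBall (chartAt Plane x x) r ⊆ (chartAt Plane x).target ∧
    (∀ y ∈ Metric.closedBall (chartAt Plane x x) r, (chartAt Plane x).symm y ∈ P →
      (chartAt Plane x).symm y = x) ∧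
    ∀ t : ℝ, loopCurve δ t = (chartAt Plane x).symm (chartAt Plane x x +
      r • !₂[Real.cos (2 * Real.pi * m * t), Real.sin (2 * Real.pi * m * t)])

/-- A loop of `M` punctured at the points of `P` is admissible if it is not homotopic, in the
punctured surface, to a point or to a multiple of a noncontractible simple loop of a cusp. -/
def IsAdmissible (P : Finset M) (γ : C(UnitAddCircle, ((P : Set M)ᶜ : Set M))) : Prop :=
  ¬ γ.Nullhomotopic ∧ ∀ x ∈ P, ∀ δ, IsCuspLoopMultiple P x δ → ¬ γ.Homotopic δ

/-- The marked homotopy systole `sys_*` of `M` punctured at the points of `P`: the infimal length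
of the admissible (piecewise smooth) loops. -/
def markedSystole (P : Finset M) (F : TangentBundle (𝓡 2) M → ℝ) : ℝ≥0∞ :=
  ⨅ (γ : C(UnitAddCircle, ((P : Set M)ᶜ : Set M)))
    (_ : PiecewiseSmooth (loopCurve γ) ∧ IsAdmissible P γ), length F (loopCurve γ)

end Loops

section Extremal

variable [MeasurableSpace M]

/-- The systolic ratio `sys / √area` of a metric on the closed surface `M`. -/
def systolicRatio (F : TangentBundle (𝓡 2) M → ℝ) : ℝ≥0∞ :=
  systole univ F / area univ F ^ (1 / 2 : ℝ)

variable [IsManifold (𝓡 2) ∞ M]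

/-- `F₀` is a systolically extremal metric of the given kind on the closed surface `M`: its
systolic ratio is at least that of every smooth metric of this kind.  The metric `F₀` is only
required to be continuous, because extremal metrics (such as the `ℓ¹` metric on the square torus)
often fail to be smooth. -/
structure IsSystolicallyExtremal (κ : MetricKind) (F₀ : TangentBundle (𝓡 2) M → ℝ) : Prop where
  isContinuousFinslerMetric : IsContinuousFinslerMetric univ F₀
  kind : κ.Holds univ F₀
  le_ratio : ∀ F : TangentBundle (𝓡 2) M → ℝ, IsFinslerMetric univ F → κ.Holds univ F →
    systolicRatio F ≤ systolicRatio F₀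

end Extremal

end SystolicSurface

end

/-! Fix `L` below the marked systole of `F`. The complete metric `F` is converted into a smooth
metric of the same category on the closed surface, `cutoffMetric`, that is √((χF)² + (δG)²). Here
`χ` is a cutoff equal to 1 away from the punctures and 0 near them, and `G` is the Riemannian metric
induced by an embedding in a Euclidean space. Extremality applies to this metric. For fixed `χ`, its
area is bounded by a quantity that tends to the area of `F` as δ → 0 (`area_cutoffMetric_le`), so it
remains to find `χ` for which its systole is at least `L` whatever δ is
(`exists_cutoff_le_systole`).

Completeness supplies `χ`. Around each puncture there is an annulus whose crossing costs `F`-length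
at least `L`, inwards if `F` is forward complete and outwards if it is backward complete
(`IsForwardComplete.exists_wall`, `IsBackwardComplete.exists_wall`). Otherwise curves of length less
than `L` would reach ever smaller circles around the puncture. Limits of their points on a sequence
of concentric level sets would form a Cauchy sequence tending to the puncture
(`exists_cauchy_of_chains`).

Let `χ` be 1 outside the small disks bounded by these annuli. A noncontractible loop of `M` that
avoids the small disks is a loop of the punctured surface. It is admissible because cusp loops
contract once the puncture is filled, so it is longer than `L`. A loop that enters a small disk
cannot stay in the corresponding large one, where it would be contractible. Being closed, it crosses
the annulus in both directions, and one of the two crossings costs at least `L`. -/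

noncomputable section

namespace SystolicSurface

variable {M : Type*} [TopologicalSpace M] [ChartedSpace Plane M]

/-! ### Piecewise smooth curves and their lengths -/

section Curves

/-- The curve `γ` is continuous on `[a, b]` and smooth on each interval of some subdivision. -/
inductive SmoothPieces (γ : ℝ → M) : ℝ → ℝ → Prop
  | refl (a : ℝ) : SmoothPieces γ a a
  | step {a b c : ℝ} : SmoothPieces γ a b → b ≤ c →
      ContMDiffOn 𝓘(ℝ, ℝ) (𝓡 2) ∞ γ (Icc b c) → SmoothPieces γ a c

namespace SmoothPieces

variable {γ γ' : ℝ → M} {a b c : ℝ}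

theorem le (h : SmoothPieces γ a b) : a ≤ b := by
  induction h with
  | refl => exact le_rfl
  | step _ hbc _ ih => exact ih.trans hbc

theorem continuousOn (h : SmoothPieces γ a b) : ContinuousOn γ (Icc a b) := by
  induction h with
  | refl => simp
  | step h hbc hγ ih =>
    rw [← Icc_union_Icc_eq_Icc h.le hbc]
    exact ih.union_of_isClosed hγ.continuousOn isClosed_Icc isClosed_Icc

theorem trans (h : SmoothPieces γ a b) (h' : SmoothPieces γ b c) : SmoothPieces γ a c := by
  induction h' with
  | refl => exact h
  | step _ hbc hγ ih => exact ih.step hbc hγ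

theorem restrict (h : SmoothPieces γ a b) {a' b' : ℝ} (ha : a ≤ a') (hab : a' ≤ b')
    (hb : b' ≤ b) : SmoothPieces γ a' b' := by
  induction h generalizing b' with
  | refl =>
    obtain rfl : a' = b' := by linarith
    exact .refl _
  | @step d c h hdc hγ ih =>
    rcases le_total b' d with hd | hd
    · exact ih hab hd
    rcases le_total a' d with hd' | hd'
    · exact (ih hd' le_rfl).step hd (hγ.mono (Icc_subset_Icc le_rfl hb))
    · exact (refl a').step hab (hγ.mono (Icc_subset_Icc hd' hb))

theorem congr (h : SmoothPieces γ a b) (hγ : EqOn γ' γ (Icc a b)) : SmoothPieces γ' a b := by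
  induction h with
  | refl => exact .refl _
  | step h hbc hs ih =>
    exact (ih (hγ.mono (Icc_subset_Icc le_rfl hbc))).step hbc
      (hs.congr fun t ht => hγ ⟨h.le.trans ht.1, ht.2⟩)

theorem comp_affine (h : SmoothPieces γ a b) {k s : ℝ} (hk : 0 < k) :
    SmoothPieces (fun t => γ (k * t + s)) ((a - s) / k) ((b - s) / k) := by
  induction h with
  | refl => exact .refl _
  | @step b c h hbc hs ih =>
    refine ih.step (by gcongr) ?_
    have hA : ContMDiff 𝓘(ℝ, ℝ) 𝓘(ℝ, ℝ) ∞ (fun t : ℝ => k * t + s) :=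
      contMDiff_iff_contDiff.2 (by fun_prop)
    refine hs.comp hA.contMDiffOn fun t ht => ?_
    rw [mem_Icc, div_le_iff₀ hk, le_div_iff₀ hk] at ht
    constructor <;> nlinarith [ht.1, ht.2]

theorem of_piecewiseSmooth (h : PiecewiseSmooth γ) : SmoothPieces γ 0 1 := by
  obtain ⟨-, n, t, ht, h0, h1, h⟩ := h
  suffices ∀ m ≤ n, SmoothPieces γ (t 0) (t m) by simpa [h0, h1] using this n le_rfl
  intro m
  induction m with
  | zero => exact fun _ => .refl _
  | succ m ih => exact fun hm => (ih (by omega)).step (ht (by omega)) (h m (by omega))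

theorem exists_subdivision (h : SmoothPieces γ a b) : ∃ (n : ℕ) (t : ℕ → ℝ), Monotone t ∧ t 0 = a ∧
    t n = b ∧ ∀ i < n, ContMDiffOn 𝓘(ℝ, ℝ) (𝓡 2) ∞ γ (Icc (t i) (t (i + 1))) := by
  induction h with
  | refl => exact ⟨0, fun _ => a, monotone_const, rfl, rfl, by simp⟩
  | @step b c h hbc hs ih =>
    obtain ⟨n, t, ht, h0, h1, hi⟩ := ih
    -- Staying at `c` past index `n` keeps the sequence monotone on all of `ℕ`.
    refine ⟨n + 1, fun i => if i ≤ n then t i else c, ?_, by simp [h0], by simp, ?_⟩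
    · intro i j hij
      dsimp only
      split_ifs with h1 h2
      · exact ht hij
      · exact (ht h1).trans (by linarith)
      · omega
      · exact le_rfl
    · intro i hin
      rcases Nat.lt_succ_iff_lt_or_eq.1 hin with hlt | rfl
      · simpa [hlt.le, Nat.succ_le_of_lt hlt] using hi i hlt
      · simpa [h1] using hs

theorem piecewiseSmooth (h : SmoothPieces γ 0 1) : PiecewiseSmooth γ :=
  ⟨h.continuousOn, h.exists_subdivision⟩

end SmoothPieces

/-- The length of the restriction of a curve to `[a, b]`. -/
def lengthOn (F : TangentBundle (𝓡 2) M → ℝ) (γ : ℝ → M) (a b : ℝ) : ℝ≥0∞ :=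
  ∫⁻ t in Icc a b, ENNReal.ofReal (F ⟨γ t, mfderiv 𝓘(ℝ, ℝ) (𝓡 2) γ t (1 : ℝ)⟩)

variable {F F' : TangentBundle (𝓡 2) M → ℝ} {γ γ' : ℝ → M} {a b c : ℝ}

theorem lengthOn_add (hab : a ≤ b) (hbc : b ≤ c) :
    lengthOn F γ a b + lengthOn F γ b c = lengthOn F γ a c := by
  unfold lengthOn
  rw [← Icc_union_Ioc_eq_Icc hab hbc, lintegral_union measurableSet_Ioc,
    restrict_Ioc_eq_restrict_Icc]
  exact disjoint_left.2 fun t ht ht' => ht.2.not_gt ht'.1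

theorem lengthOn_mono_interval {a' b' : ℝ} (ha : a ≤ a') (hb : b' ≤ b) :
    lengthOn F γ a' b' ≤ lengthOn F γ a b :=
  lintegral_mono_set (Icc_subset_Icc ha hb)

/-- Endpoints are negligible and the derivative is local, so behaviour outside the open interval is
irrelevant. This allows curves to be glued piece by piece. -/
theorem lengthOn_congr (h : EqOn γ γ' (Ioo a b)) : lengthOn F γ a b = lengthOn F γ' a b := by
  unfold lengthOn
  rw [← restrict_Ioo_eq_restrict_Icc]
  refine setLIntegral_congr_fun measurableSet_Ioo fun t ht => ?_
  have he : γ =ᶠ[𝓝 t] γ' := h.eventuallyEq_of_mem (Ioo_mem_nhds ht.1 ht.2)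
  have : (⟨γ t, mfderiv 𝓘(ℝ, ℝ) (𝓡 2) γ t (1 : ℝ)⟩ : TangentBundle (𝓡 2) M)
      = ⟨γ' t, mfderiv 𝓘(ℝ, ℝ) (𝓡 2) γ' t (1 : ℝ)⟩ := by
    rw [he.mfderiv_eq, he.self_of_nhds]
  simp only [this]

theorem lengthOn_mono_metric
    (h : ∀ t ∈ Icc a b, ∀ v : TangentSpace (𝓡 2) (γ t), F ⟨γ t, v⟩ ≤ F' ⟨γ t, v⟩) :
    lengthOn F γ a b ≤ lengthOn F' γ a b :=
  setLIntegral_mono' measurableSet_Icc fun t ht => ENNReal.ofReal_le_ofReal (h t ht _)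

/-- Differentiability is not needed: an invertible affine change preserves its failure, and both
derivatives then take the default value 0. -/
theorem mfderiv_comp_affine {k s : ℝ} (hk : k ≠ 0) (t : ℝ) :
    mfderiv 𝓘(ℝ, ℝ) (𝓡 2) (fun t => γ (k * t + s)) t (1 : ℝ) =
      k • (mfderiv 𝓘(ℝ, ℝ) (𝓡 2) γ (k * t + s) (1 : ℝ) : TangentSpace (𝓡 2) (γ (k * t + s))) := by
  have hA : HasDerivAt (fun t : ℝ => k * t + s) k t := by
    simpa using ((hasDerivAt_id t).const_mul k).add_const s
  have hAm := hA.hasFDerivAt.hasMFDerivAt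
  by_cases h : MDifferentiableAt 𝓘(ℝ, ℝ) (𝓡 2) γ (k * t + s)
  · have := (h.hasMFDerivAt.comp t hAm).mfderiv
    change mfderiv 𝓘(ℝ, ℝ) (𝓡 2) (γ ∘ fun t => k * t + s) t (1 : ℝ) = _
    rw [this]
    have h1 : (ContinuousLinearMap.toSpanSingleton ℝ k : ℝ →L[ℝ] ℝ) 1 = k • 1 := by simp
    refine Eq.trans (congrArg (mfderiv 𝓘(ℝ, ℝ) (𝓡 2) γ (k * t + s)) h1) ?_
    exact map_smul (mfderiv 𝓘(ℝ, ℝ) (𝓡 2) γ (k * t + s)) k (1 : ℝ)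
  · have h' : ¬ MDifferentiableAt 𝓘(ℝ, ℝ) (𝓡 2) (fun t => γ (k * t + s)) t := by
      intro h'
      apply h
      have hB : HasDerivAt (fun u : ℝ => k⁻¹ * u + (-s / k)) k⁻¹ (k * t + s) := by
        simpa using ((hasDerivAt_id (k * t + s)).const_mul k⁻¹).add_const (-s / k)
      have ht : k⁻¹ * (k * t + s) + (-s / k) = t := by field_simp; ring
      rw [← ht] at h'
      have := MDifferentiableAt.comp (f := fun u : ℝ => k⁻¹ * u + (-s / k)) (k * t + s) h'
        hB.hasFDerivAt.hasMFDerivAt.mdifferentiableAt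
      refine this.congr_of_eventuallyEq (Eventually.of_forall fun u => ?_)
      simp only [Function.comp]
      congr 1
      field_simp
      ring
    rw [mfderiv_zero_of_not_mdifferentiableAt h, mfderiv_zero_of_not_mdifferentiableAt h']
    exact (smul_zero k).symm

/-- A translation does not rescale velocities, so this holds for an arbitrary `F`, without
homogeneity. -/
theorem lengthOn_comp_add (k : ℝ) :
    lengthOn F (fun t => γ (t + k)) a b = lengthOn F γ (a + k) (b + k) := by
  unfold lengthOn
  rw [← image_add_const_Icc,
    lintegral_image_eq_lintegral_abs_deriv_mul measurableSet_Icc (f' := fun _ => 1)]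
  · refine setLIntegral_congr_fun measurableSet_Icc fun t ht => ?_
    -- The type of the velocity depends on the base point. A variable `A` lets `1 * u + k` replace
    -- `u + k` in both at once.
    have h (A : ℝ → ℝ) (hA : A = fun u => 1 * u + k) :
        F ⟨γ (A t), mfderiv 𝓘(ℝ, ℝ) (𝓡 2) (fun u => γ (A u)) t (1 : ℝ)⟩ =
          F ⟨γ (A t), mfderiv 𝓘(ℝ, ℝ) (𝓡 2) γ (A t) (1 : ℝ)⟩ := by
      subst hA
      rw [mfderiv_comp_affine one_ne_zero, one_smul]
    rw [abs_one, ENNReal.ofReal_one, one_mul, h (fun t => t + k) (by simp)]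
  · intro t _
    simpa using ((hasDerivAt_id t).add_const k).hasDerivWithinAt
  · exact (add_left_injective k).injOn

end Curves

/-! ### The asymmetric distance -/

section Dist

variable [IsManifold (𝓡 2) ∞ M] {F : TangentBundle (𝓡 2) M → ℝ} {γ γ' : ℝ → M} {a b c : ℝ}
  {U : Set M}

theorem IsContinuousFinslerMetric.map_zero (hF : IsContinuousFinslerMetric U F) {x : M}
    (hx : x ∈ U) : F ⟨x, 0⟩ = 0 := by
  simpa using hF.homogeneous x hx 0 le_rfl 0

theorem IsContinuousFinslerMetric.nonneg (hF : IsContinuousFinslerMetric U F) {x : M}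
    (hx : x ∈ U) (v : TangentSpace (𝓡 2) x) : 0 ≤ F ⟨x, v⟩ := by
  rcases eq_or_ne v 0 with rfl | hv
  · exact (hF.map_zero hx).ge
  · exact (hF.pos x hx v hv).le

theorem lengthOn_comp_affine (hF : IsContinuousFinslerMetric U F) {k s : ℝ} (hk : 0 < k)
    (hγ : MapsTo γ (Icc (k * a + s) (k * b + s)) U) :
    lengthOn F (fun t => γ (k * t + s)) a b = lengthOn F γ (k * a + s) (k * b + s) := by
  unfold lengthOn
  rw [← image_affine_Icc' hk,
    lintegral_image_eq_lintegral_abs_deriv_mul measurableSet_Icc (f' := fun _ => k)]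
  · refine setLIntegral_congr_fun measurableSet_Icc fun t ht => ?_
    have hU : γ (k * t + s) ∈ U := hγ (by rw [← image_affine_Icc' hk]; exact ⟨t, ht, rfl⟩)
    simp only [abs_of_pos hk]
    rw [← ENNReal.ofReal_mul hk.le, ← hF.homogeneous _ hU k hk.le, mfderiv_comp_affine hk.ne']
  · intro t _
    simpa using (((hasDerivAt_id t).const_mul k).add_const s).hasDerivWithinAt
  · intro t _ u _ h
    simpa [hk.ne'] using h

theorem finslerDist_le_lengthOn (hF : IsContinuousFinslerMetric U F) (hab : a ≤ b)
    (h : SmoothPieces γ a b) (hγ : MapsTo γ (Icc a b) U) :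
    finslerDist U F (γ a) (γ b) ≤ lengthOn F γ a b := by
  -- A degenerate interval cannot be rescaled to `[0, 1]`; the constant curve, of length 0, is used
  -- instead.
  rcases hab.eq_or_lt with rfl | hab
  · have hU : γ a ∈ U := hγ (by simp)
    have hps : PiecewiseSmooth fun _ : ℝ => γ a := ((SmoothPieces.refl (γ := fun _ => γ a) 0).step
      zero_le_one contMDiffOn_const).piecewiseSmooth
    refine (iInf₂_le (fun _ => γ a) ⟨hps, fun _ _ => hU, rfl, rfl⟩).trans ?_
    · refine (lintegral_eq_zero_of_ae_eq_zero (Eventually.of_forall fun t => ?_)).le.trans bot_le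
      have h0 : mfderiv 𝓘(ℝ, ℝ) (𝓡 2) (fun _ : ℝ => γ a) t (1 : ℝ) =
          (0 : TangentSpace (𝓡 2) (γ a)) := by
        rw [mfderiv_const]; rfl
      refine (congrArg (fun w : TangentSpace (𝓡 2) (γ a) => ENNReal.ofReal (F ⟨γ a, w⟩)) h0).trans ?_
      simp [hF.map_zero hU]
  have hk : 0 < b - a := sub_pos.2 hab
  have hps : PiecewiseSmooth fun t => γ ((b - a) * t + a) := by
    have := h.comp_affine (s := a) hk
    rw [sub_self, zero_div, div_self hk.ne'] at this
    exact this.piecewiseSmooth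
  have hU : MapsTo (fun t => γ ((b - a) * t + a)) (Icc 0 1) U := fun t ht =>
    hγ ⟨by nlinarith [ht.1], by nlinarith [ht.2]⟩
  refine (iInf₂_le (fun t => γ ((b - a) * t + a)) ⟨hps, hU, by simp, by simp⟩).trans ?_
  have := lengthOn_comp_affine (a := 0) (b := 1) (s := a) hF hk (by simpa using hγ)
  simp only [mul_zero, zero_add, mul_one, sub_add_cancel] at this
  exact this.le

theorem finslerDist_triangle (hF : IsContinuousFinslerMetric U F) (x y z : M) :
    finslerDist U F x z ≤ finslerDist U F x y + finslerDist U F y z := by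
  simp only [finslerDist.eq_1 U F x y, finslerDist.eq_1 U F y z, ENNReal.iInf_add,
    ENNReal.add_iInf]
  refine le_iInf fun γ₂ => le_iInf fun h₂ => le_iInf fun γ₁ => le_iInf fun h₁ => ?_
  obtain ⟨hs₁, hU₁, hx₁, hy₁⟩ := h₁
  obtain ⟨hs₂, hU₂, hx₂, hy₂⟩ := h₂
  set c : ℝ → M := fun t => if t ≤ 1 then γ₁ t else γ₂ (t - 1) with hc
  have e₁ : EqOn c γ₁ (Icc 0 1) := fun t ht => by simp [hc, ht.2]
  have e₂ : EqOn c (fun t => γ₂ (t + -1)) (Icc 1 2) := fun t ht => by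
    rcases ht.1.eq_or_lt with rfl | h
    · simp [hc, hy₁, hx₂]
    · simp [hc, h.not_ge, sub_eq_add_neg]
  have s₂ : SmoothPieces (fun t => γ₂ (t + -1)) 1 2 := by
    have := (SmoothPieces.of_piecewiseSmooth hs₂).comp_affine (k := 1) (s := -1) one_pos
    norm_num at this ⊢
    exact this
  have hcs : SmoothPieces c 0 2 :=
    ((SmoothPieces.of_piecewiseSmooth hs₁).congr e₁).trans (s₂.congr e₂)
  have hcU : MapsTo c (Icc 0 2) U := by
    intro t ht
    rcases le_total t 1 with h | h
    · rw [e₁ ⟨ht.1, h⟩]; exact hU₁ ⟨ht.1, h⟩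
    · rw [e₂ ⟨h, ht.2⟩]; exact hU₂ ⟨by linarith, by linarith [ht.2]⟩
  have h0 : c 0 = x := by simp [hc, hx₁]
  have h2 : c 2 = z := by rw [e₂ (by norm_num)]; norm_num [hy₂]
  have := finslerDist_le_lengthOn hF zero_le_two hcs hcU
  rw [h0, h2, ← lengthOn_add zero_le_one one_le_two, lengthOn_congr (e₁.mono Ioo_subset_Icc_self),
    lengthOn_congr (e₂.mono Ioo_subset_Icc_self), lengthOn_comp_add] at this
  norm_num at this
  exact this

end Dist

/-! ### Local comparison with the Euclidean metric in charts -/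

section ChartMetric

theorem isOpen_chart_preimage {U : Set M} {p : M} (hU : IsOpen U) :
    IsOpen ((chartAt Plane p).target ∩ (chartAt Plane p).symm ⁻¹' U) :=
  (chartAt Plane p).isOpen_inter_preimage_symm hU

theorem ball_mem_nhds_of_chart {x : M} {r : ℝ} (hr : 0 < r) :
    (chartAt Plane x).source ∩ chartAt Plane x ⁻¹' Metric.ball (chartAt Plane x x) r ∈ 𝓝 x :=
  inter_mem (chart_source_mem_nhds _ x)
    (((chartAt Plane x).continuousAt (mem_chart_source Plane x)).preimage_mem_nhds (Metric.ball_mem_nhds _ hr))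

variable [IsManifold (𝓡 2) ∞ M] {F F' : TangentBundle (𝓡 2) M → ℝ} {U : Set M} {p x : M}

/-- The expression of `F` in the chart at `p`. -/
def chartMetric (F : TangentBundle (𝓡 2) M → ℝ) (p : M) (y v : Plane) : ℝ :=
  F ⟨(chartAt Plane p).symm y, mfderiv (𝓡 2) (𝓡 2) (chartAt Plane p).symm y v⟩

theorem mfderiv_chart_symm_injective {y : Plane} (hy : y ∈ (chartAt Plane p).target) :
    Function.Injective (mfderiv (𝓡 2) (𝓡 2) (chartAt Plane p).symm y) :=
  ((mdifferentiable_chart (I := 𝓡 2) p).symm (e := chartAt Plane p)).mfderiv_injective hy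

theorem mfderiv_chart_symm_surjective {y : Plane} (hy : y ∈ (chartAt Plane p).target) :
    Function.Surjective (mfderiv (𝓡 2) (𝓡 2) (chartAt Plane p).symm y) :=
  ((mdifferentiable_chart (I := 𝓡 2) p).symm (e := chartAt Plane p)).mfderiv_surjective hy

theorem chartMetric_smul (hF : IsContinuousFinslerMetric U F) {y : Plane}
    (hy : (chartAt Plane p).symm y ∈ U) {t : ℝ} (ht : 0 ≤ t) (v : Plane) :
    chartMetric F p y (t • v) = t * chartMetric F p y v := by
  unfold chartMetric
  rw [← hF.homogeneous _ hy t ht]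
  congr 2
  exact map_smul (mfderiv (𝓡 2) (𝓡 2) (chartAt Plane p).symm y) t v

theorem chartMetric_pos (hF : IsContinuousFinslerMetric U F) {y : Plane}
    (hy : y ∈ (chartAt Plane p).target) (hyU : (chartAt Plane p).symm y ∈ U) {v : Plane}
    (hv : v ≠ 0) : 0 < chartMetric F p y v := by
  refine hF.pos _ hyU _ fun h => hv ?_
  exact mfderiv_chart_symm_injective hy
    (h.trans (map_zero (mfderiv (𝓡 2) (𝓡 2) (chartAt Plane p).symm y)).symm)

/-- The expression in the chart is `F` composed with the tangent map of the inverse chart, which is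
continuous because the chart is smooth. -/
theorem continuousOn_chartMetric (hF : IsContinuousFinslerMetric U F) :
    ContinuousOn (fun q : Plane × Plane => chartMetric F p q.1 q.2)
      {q | q.1 ∈ (chartAt Plane p).target ∧ (chartAt Plane p).symm q.1 ∈ U} := by
  have h1 : ContMDiffOn (𝓡 2) (𝓡 2) ∞ (chartAt Plane p).symm (chartAt Plane p).target :=
    contMDiffOn_chart_symm
  have h2 := h1.continuousOn_tangentMapWithin (by simp)
    (chartAt Plane p).open_target.uniqueMDiffOn
  have h3 : Continuous fun q : Plane × Plane => (⟨q.1, q.2⟩ : TangentBundle (𝓡 2) Plane) :=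
    (tangentBundleModelSpaceHomeomorph (𝓡 2)).symm.continuous
  have h4 : ContinuousOn (fun q : Plane × Plane =>
      tangentMapWithin (𝓡 2) (𝓡 2) (chartAt Plane p).symm (chartAt Plane p).target ⟨q.1, q.2⟩)
      {q | q.1 ∈ (chartAt Plane p).target ∧ (chartAt Plane p).symm q.1 ∈ U} :=
    h2.comp h3.continuousOn fun q hq => hq.1
  refine (hF.continuousOn.comp h4 fun q hq => hq.2).congr fun q hq => ?_
  simp only [chartMetric, Function.comp, tangentMapWithin]
  rw [mfderivWithin_of_isOpen (chartAt Plane p).open_target hq.1]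

/-- In a chart, a Finsler metric is locally comparable to the Euclidean metric. -/
theorem exists_chartMetric_bounds (hF : IsContinuousFinslerMetric U F) (hU : IsOpen U) {y₀ : Plane}
    (hy₀ : y₀ ∈ (chartAt Plane p).target) (hyU : (chartAt Plane p).symm y₀ ∈ U) :
    ∃ r > 0, ∃ c > 0, ∃ C > 0, Metric.ball y₀ r ⊆ (chartAt Plane p).target ∩
      (chartAt Plane p).symm ⁻¹' U ∧ ∀ y ∈ Metric.ball y₀ r, ∀ v,
        c * ‖v‖ ≤ chartMetric F p y v ∧ chartMetric F p y v ≤ C * ‖v‖ := by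
  obtain ⟨r, hr, hball⟩ := Metric.nhds_basis_closedBall.mem_iff.1
    ((isOpen_chart_preimage (p := p) hU).mem_nhds ⟨hy₀, hyU⟩)
  -- The extrema over this compact set of unit vectors give the two constants; homogeneity extends
  -- the bounds to all vectors.
  set K : Set (Plane × Plane) := Metric.closedBall y₀ r ×ˢ Metric.sphere 0 1 with hK
  have hKc : IsCompact K := (isCompact_closedBall _ _).prod (isCompact_sphere _ _)
  have hcont : ContinuousOn (fun q : Plane × Plane => chartMetric F p q.1 q.2) K :=
    (continuousOn_chartMetric hF).mono fun q hq => hball hq.1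
  have hKn : K.Nonempty := (Metric.nonempty_closedBall.2 hr.le).prod
    (NormedSpace.sphere_nonempty.2 zero_le_one)
  obtain ⟨m, hm, hmin⟩ := hKc.exists_isMinOn hKn hcont
  obtain ⟨m', hm', hmax⟩ := hKc.exists_isMaxOn hKn hcont
  have hpos : ∀ q ∈ K, 0 < chartMetric F p q.1 q.2 := fun q hq =>
    chartMetric_pos hF (hball hq.1).1 (hball hq.1).2 (Metric.ne_of_mem_sphere hq.2 one_ne_zero)
  refine ⟨r, hr, _, hpos m hm, _, hpos m' hm', Metric.ball_subset_closedBall.trans hball, ?_⟩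
  intro y hy v
  have hy' := Metric.ball_subset_closedBall hy
  rcases eq_or_ne v 0 with rfl | hv
  · have := chartMetric_smul hF (hball hy').2 le_rfl (0 : Plane)
    simp at this
    simp [this]
  have hv' : 0 < ‖v‖ := norm_pos_iff.2 hv
  have hq : (y, ‖v‖⁻¹ • v) ∈ K := ⟨hy', by simp [norm_smul, hv]⟩
  have h := chartMetric_smul hF (hball hy').2 hv'.le (‖v‖⁻¹ • v)
  rw [smul_inv_smul₀ hv'.ne'] at h
  rw [h, mul_comm _ ‖v‖, mul_comm _ ‖v‖]
  exact ⟨mul_le_mul_of_nonneg_left (hmin hq) hv'.le, mul_le_mul_of_nonneg_left (hmax hq) hv'.le⟩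

theorem exists_nhds_le_mul (hF : IsContinuousFinslerMetric U F)
    (hF' : IsContinuousFinslerMetric U F') (hU : IsOpen U) (hx : x ∈ U) :
    ∃ N ∈ 𝓝 x, ∃ C > 0, ∀ z ∈ N, ∀ v : TangentSpace (𝓡 2) z, F ⟨z, v⟩ ≤ C * F' ⟨z, v⟩ := by
  have hx' : (chartAt Plane x).symm (chartAt Plane x x) ∈ U := by simpa
  obtain ⟨r, hr, c, hc, C, hC, hb, h⟩ :=
    exists_chartMetric_bounds hF hU (mem_chart_target Plane x) hx'
  obtain ⟨r', hr', c', hc', C', hC', hb', h'⟩ :=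
    exists_chartMetric_bounds hF' hU (mem_chart_target Plane x) hx'
  refine ⟨_, ball_mem_nhds_of_chart (lt_min hr hr'), C / c', by positivity, ?_⟩
  rintro z ⟨hz, hzb⟩ v
  obtain ⟨y, hy, rfl⟩ : ∃ y ∈ (chartAt Plane x).target, (chartAt Plane x).symm y = z :=
    ⟨chartAt Plane x z, (chartAt Plane x).map_source hz, (chartAt Plane x).left_inv hz⟩
  rw [mem_preimage, (chartAt Plane x).right_inv hy] at hzb
  obtain ⟨w, rfl⟩ := mfderiv_chart_symm_surjective hy v
  change Plane at w
  have h1 := (h y (Metric.ball_subset_ball (min_le_left _ _) hzb) w).2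
  have h2 := (h' y (Metric.ball_subset_ball (min_le_right _ _) hzb) w).1
  change chartMetric F x y w ≤ C / c' * chartMetric F' x y w
  calc chartMetric F x y w ≤ C * ‖w‖ := h1
    _ = C / c' * (c' * ‖w‖) := by field_simp
    _ ≤ _ := by gcongr

theorem exists_le_mul_of_isCompact (hF : IsContinuousFinslerMetric U F)
    (hF' : IsContinuousFinslerMetric U F') (hU : IsOpen U) {K : Set M} (hK : IsCompact K)
    (hKU : K ⊆ U) :
    ∃ C > 0, ∀ z ∈ K, ∀ v : TangentSpace (𝓡 2) z, F ⟨z, v⟩ ≤ C * F' ⟨z, v⟩ := by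
  -- Compact induction runs over sets that need not lie in `U`, whence the added membership.
  suffices ∃ C > 0, ∀ z ∈ K, z ∈ U → ∀ v : TangentSpace (𝓡 2) z, F ⟨z, v⟩ ≤ C * F' ⟨z, v⟩ by
    obtain ⟨C, hC, h⟩ := this
    exact ⟨C, hC, fun z hz => h z hz (hKU hz)⟩
  refine hK.induction_on (p := fun K => ∃ C > 0, ∀ z ∈ K, z ∈ U → ∀ v : TangentSpace (𝓡 2) z,
    F ⟨z, v⟩ ≤ C * F' ⟨z, v⟩) ⟨1, one_pos, by simp⟩ ?_ ?_ ?_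
  · rintro s t hst ⟨C, hC, h⟩
    exact ⟨C, hC, fun z hz => h z (hst hz)⟩
  · rintro s t ⟨C, hC, h⟩ ⟨C', hC', h'⟩
    refine ⟨max C C', lt_max_of_lt_left hC, fun z hz hzU v => ?_⟩
    have h0 := hF'.nonneg hzU v
    rcases hz with hz | hz
    · exact (h z hz hzU v).trans (mul_le_mul_of_nonneg_right (le_max_left _ _) h0)
    · exact (h' z hz hzU v).trans (mul_le_mul_of_nonneg_right (le_max_right _ _) h0)
  · intro x hx
    obtain ⟨N, hN, C, hC, h⟩ := exists_nhds_le_mul hF hF' hU (hKU hx)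
    exact ⟨N, mem_nhdsWithin_of_mem_nhds hN, C, hC, fun z hz _ => h z hz⟩

/-- A ball in the chart is convex, so the straight segment between two of its points is an
admissible competitor. -/
theorem exists_finslerDist_le (hF : IsContinuousFinslerMetric U F) (hU : IsOpen U) (hx : x ∈ U) :
    ∃ N ∈ 𝓝 x, ∃ C : ℝ, ∀ y ∈ N, ∀ z ∈ N, finslerDist U F y z ≤
      ENNReal.ofReal (C * ‖chartAt Plane x z - chartAt Plane x y‖) := by
  have hx' : (chartAt Plane x).symm (chartAt Plane x x) ∈ U := by simpa
  obtain ⟨r, hr, c, hc, C, hC, hb, h⟩ :=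
    exists_chartMetric_bounds hF hU (mem_chart_target Plane x) hx'
  refine ⟨_, ball_mem_nhds_of_chart hr, C, ?_⟩
  rintro y ⟨hy, hyb⟩ z ⟨hz, hzb⟩
  set φ := chartAt Plane x with hφ
  set A : ℝ → Plane := fun t => φ y + t • (φ z - φ y) with hA
  have hAb : MapsTo A (Icc 0 1) (Metric.ball (φ x) r) := fun t ht =>
    (convex_ball (φ x) r).add_smul_sub_mem hyb hzb ht
  have hAd (t : ℝ) : HasDerivAt A (φ z - φ y) t := by
    have := ((hasDerivAt_id t).smul_const (φ z - φ y)).const_add (φ y)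
    rwa [one_smul] at this
  have hAs : ContMDiff 𝓘(ℝ, ℝ) (𝓡 2) ∞ A := contMDiff_iff_contDiff.2 (by fun_prop)
  have hs : ContMDiffOn 𝓘(ℝ, ℝ) (𝓡 2) ∞ (fun t => φ.symm (A t)) (Icc 0 1) :=
    (contMDiffOn_chart_symm (I := 𝓡 2) (x := x)).comp hAs.contMDiffOn fun t ht => (hb (hAb ht)).1
  have hd (t : ℝ) (ht : t ∈ Icc (0 : ℝ) 1) :
      mfderiv 𝓘(ℝ, ℝ) (𝓡 2) (fun t => φ.symm (A t)) t (1 : ℝ) =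
        mfderiv (𝓡 2) (𝓡 2) φ.symm (A t) (φ z - φ y) := by
    have h1 := ((mdifferentiable_chart (I := 𝓡 2) x).mdifferentiableAt_symm
      (hb (hAb ht)).1).hasMFDerivAt.comp t (hAd t).hasFDerivAt.hasMFDerivAt
    refine Eq.trans (congrArg (fun L : ℝ →L[ℝ] Plane => L 1) h1.mfderiv) ?_
    exact congrArg (mfderiv (𝓡 2) (𝓡 2) φ.symm (A t)) (one_smul ℝ (φ z - φ y))
  have hl := finslerDist_le_lengthOn hF zero_le_one ((SmoothPieces.refl 0).step zero_le_one hs)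
    fun t ht => (hb (hAb ht)).2
  have h0 : φ.symm (A 0) = y := by simpa [hA] using φ.left_inv hy
  have h1 : φ.symm (A 1) = z := by simpa [hA] using φ.left_inv hz
  rw [h0, h1] at hl
  refine hl.trans ?_
  calc lengthOn F (fun t => φ.symm (A t)) 0 1
      ≤ ∫⁻ _ in Icc (0 : ℝ) 1, ENNReal.ofReal (C * ‖φ z - φ y‖) := by
        refine setLIntegral_mono' measurableSet_Icc fun t ht => ENNReal.ofReal_le_ofReal ?_
        rw [hd t ht]
        exact (h _ (hAb ht) _).2
    _ = _ := by simp

theorem tendsto_finslerDist_left (hF : IsContinuousFinslerMetric U F) (hU : IsOpen U)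
    (hx : x ∈ U) : Tendsto (fun y => finslerDist U F x y) (𝓝 x) (𝓝 0) := by
  obtain ⟨N, hN, C, h⟩ := exists_finslerDist_le hF hU hx
  have hc : Tendsto (fun y => ENNReal.ofReal (C * ‖chartAt Plane x y - chartAt Plane x x‖))
      (𝓝 x) (𝓝 0) := by
    have h1 := ((((chartAt Plane x).continuousAt (mem_chart_source Plane x)).sub
      (continuousAt_const (y := chartAt Plane x x))).norm.const_mul C)
    simpa using (ENNReal.tendsto_ofReal h1.tendsto)
  refine tendsto_of_tendsto_of_tendsto_of_le_of_le' tendsto_const_nhds hc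
    (Eventually.of_forall fun _ => zero_le) ?_
  filter_upwards [hN] with y hy using h x (mem_of_mem_nhds hN) y hy

theorem tendsto_finslerDist_right (hF : IsContinuousFinslerMetric U F) (hU : IsOpen U)
    (hx : x ∈ U) : Tendsto (fun y => finslerDist U F y x) (𝓝 x) (𝓝 0) := by
  obtain ⟨N, hN, C, h⟩ := exists_finslerDist_le hF hU hx
  have hc : Tendsto (fun y => ENNReal.ofReal (C * ‖chartAt Plane x x - chartAt Plane x y‖))
      (𝓝 x) (𝓝 0) := by
    have h1 := (((continuousAt_const (y := chartAt Plane x x)).sub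
      ((chartAt Plane x).continuousAt (mem_chart_source Plane x))).norm.const_mul C)
    simpa using (ENNReal.tendsto_ofReal h1.tendsto)
  refine tendsto_of_tendsto_of_tendsto_of_le_of_le' tendsto_const_nhds hc
    (Eventually.of_forall fun _ => zero_le) ?_
  filter_upwards [hN] with y hy using h y hy x (mem_of_mem_nhds hN)

end ChartMetric

/-! ### Areas of co-disks -/

section Codisk

/-- The unit co-disk of the function `H` on the plane. -/
def codisk (H : Plane → ℝ) : Set Plane := {ξ | ∀ v, inner ℝ ξ v ≤ H v}

theorem codisk_mono {H H' : Plane → ℝ} (h : H ≤ H') : codisk H ⊆ codisk H' :=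
  fun _ hξ v => (hξ v).trans (h v)

theorem volume_codisk_mul (H : Plane → ℝ) {t : ℝ} (ht : 0 < t) :
    volume (codisk fun v => t * H v) = ENNReal.ofReal (t ^ 2) * volume (codisk H) := by
  have : (codisk fun v => t * H v) = (t • · : Plane → Plane) '' codisk H := by
    ext ξ
    constructor
    · intro hξ
      refine ⟨t⁻¹ • ξ, fun v => ?_, smul_inv_smul₀ ht.ne' ξ⟩
      rw [real_inner_smul_left, inv_mul_le_iff₀ ht]
      exact hξ v
    · rintro ⟨η, hη, rfl⟩ v
      change inner ℝ (t • η) v ≤ t * H v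
      rw [real_inner_smul_left]
      exact mul_le_mul_of_nonneg_left (hη v) ht.le
  rw [this, image_smul, Measure.addHaar_smul]
  simp [abs_of_pos ht]

theorem det_adjoint_plane (A : Plane →ₗ[ℝ] Plane) :
    LinearMap.det A.adjoint = LinearMap.det A := by
  set b := EuclideanSpace.basisFun (Fin 2) ℝ
  rw [← LinearMap.det_toMatrix b.toBasis A, ← LinearMap.det_toMatrix b.toBasis,
    LinearMap.toMatrix_adjoint, Matrix.det_conjTranspose, star_trivial]

theorem bijective_iff_det_ne_zero (A : Plane →ₗ[ℝ] Plane) :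
    Function.Bijective A ↔ LinearMap.det A ≠ 0 := by
  rw [← isUnit_iff_ne_zero, ← LinearMap.isUnit_iff_isUnit_det, Module.End.isUnit_iff]

/-- Pulling a norm back by `A` moves its co-disk by the adjoint of `A`, which has the same
determinant. -/
theorem volume_codisk_comp (H : Plane → ℝ) (A : Plane →ₗ[ℝ] Plane)
    (hA : Function.Bijective A) :
    volume (codisk fun v => H (A v)) = ENNReal.ofReal |LinearMap.det A| * volume (codisk H) := by
  have hsurj : Function.Surjective A.adjoint := by
    rw [bijective_iff_det_ne_zero, ← det_adjoint_plane, ← bijective_iff_det_ne_zero] at hA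
    exact hA.2
  have : (codisk fun v => H (A v)) = A.adjoint '' codisk H := by
    ext ξ
    constructor
    · intro hξ
      obtain ⟨η, rfl⟩ := hsurj ξ
      refine ⟨η, fun v => ?_, rfl⟩
      obtain ⟨w, rfl⟩ := hA.2 v
      simpa [LinearMap.adjoint_inner_left] using hξ w
    · rintro ⟨η, hη, rfl⟩ v
      simpa [LinearMap.adjoint_inner_left] using hη (A v)
  rw [this, Measure.addHaar_image_linearMap, det_adjoint_plane]

theorem closedBall_subset_codisk {H : Plane → ℝ} {c : ℝ} (h : ∀ v, c * ‖v‖ ≤ H v) :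
    Metric.closedBall 0 c ⊆ codisk H := by
  intro ξ hξ v
  rw [mem_closedBall_zero_iff] at hξ
  exact ((real_inner_le_norm ξ v).trans (by gcongr)).trans (h v)

theorem codisk_subset_closedBall {H : Plane → ℝ} {C : ℝ} (hC : 0 ≤ C)
    (h : ∀ v, H v ≤ C * ‖v‖) : codisk H ⊆ Metric.closedBall 0 C := by
  intro ξ hξ
  rw [mem_closedBall_zero_iff]
  have h1 := (hξ ξ).trans (h ξ)
  rw [real_inner_self_eq_norm_mul_norm] at h1
  rcases (norm_nonneg ξ).eq_or_lt with h0 | h0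
  · rw [← h0]; exact hC
  · exact le_of_mul_le_mul_right h1 h0

theorem holmesThompsonDensity_eq (F : TangentBundle (𝓡 2) M → ℝ) (p : M) :
    holmesThompsonDensity F p =
      fun y => volume (codisk (fun v => F ⟨(chartAt Plane p).symm y,
        mfderiv (𝓡 2) (𝓡 2) (chartAt Plane p).symm y v⟩)) / ENNReal.ofReal Real.pi := rfl

end Codisk

/-! ### Change of chart for the area density -/

section Transition

variable [IsManifold (𝓡 2) ∞ M] {F : TangentBundle (𝓡 2) M → ℝ} {p q : M}

theorem tangent_chart_symm_chart {z : M} (hz : z ∈ (chartAt Plane q).source)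
    (w : TangentSpace (𝓡 2) z) :
    (⟨(chartAt Plane q).symm (chartAt Plane q z), mfderiv (𝓡 2) (𝓡 2) (chartAt Plane q).symm
      (chartAt Plane q z) (mfderiv (𝓡 2) (𝓡 2) (chartAt Plane q) z w)⟩ :
      TangentBundle (𝓡 2) M) = ⟨z, w⟩ := by
  have key (z z' : M) (h : z = z') (w w' : Plane) (hw : w = w') :
      (⟨z, w⟩ : TangentBundle (𝓡 2) M) = ⟨z', w'⟩ := by rw [h, hw]
  refine key _ _ ((chartAt Plane q).left_inv hz) _ _ ?_
  exact congrArg (fun L : Plane →L[ℝ] Plane => L w)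
    ((mdifferentiable_chart (I := 𝓡 2) q).symm_comp_deriv hz)

/-- The derivative of the transition from the chart at `p` to the chart at `q`. -/
def transitionDeriv (p q : M) (y : Plane) : Plane →L[ℝ] Plane :=
  (mfderiv (𝓡 2) (𝓡 2) (chartAt Plane q) ((chartAt Plane p).symm y) : Plane →L[ℝ] Plane).comp
    (mfderiv (𝓡 2) (𝓡 2) (chartAt Plane p).symm y : Plane →L[ℝ] Plane)

theorem hasFDerivAt_transition {y : Plane} (hy : y ∈ (chartAt Plane p).target)
    (hq : (chartAt Plane p).symm y ∈ (chartAt Plane q).source) :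
    HasFDerivAt (fun y => chartAt Plane q ((chartAt Plane p).symm y)) (transitionDeriv p q y) y :=
  (((mdifferentiable_chart (I := 𝓡 2) q).mdifferentiableAt hq).hasMFDerivAt.comp y
    ((mdifferentiable_chart (I := 𝓡 2) p).mdifferentiableAt_symm hy).hasMFDerivAt).hasFDerivAt

/-- By the chain rule the norm read in one chart is the pull-back of the other by the transition
derivative. The resulting factor is the Jacobian of the change of variables. -/
theorem holmesThompsonDensity_transition {y : Plane} (hy : y ∈ (chartAt Plane p).target)
    (hq : (chartAt Plane p).symm y ∈ (chartAt Plane q).source) :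
    holmesThompsonDensity F p y = ENNReal.ofReal |(transitionDeriv p q y).det| *
      holmesThompsonDensity F q (chartAt Plane q ((chartAt Plane p).symm y)) := by
  have hbij : Function.Bijective (transitionDeriv p q y : Plane →ₗ[ℝ] Plane) :=
    ((mdifferentiable_chart (I := 𝓡 2) q).mfderiv_bijective hq).comp
      ⟨mfderiv_chart_symm_injective hy, mfderiv_chart_symm_surjective hy⟩
  simp only [holmesThompsonDensity_eq]
  rw [← mul_div_assoc, ContinuousLinearMap.det, ← volume_codisk_comp _ _ hbij]
  congr 3
  ext v
  exact congrArg F (tangent_chart_symm_chart hq _).symm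

end Transition

/-! ### Holmes–Thompson area: comparison, positivity, finiteness -/

section Area

theorem chartArea_le_area [MeasurableSpace M] (U : Set M) (F : TangentBundle (𝓡 2) M → ℝ) (p : M) (s : Set M) :
    chartArea U F p s ≤ area U F :=
  ((le_iSup (fun p => chartArea U F p) p) s).trans (measure_mono (subset_univ s))

variable [MeasurableSpace M] [BorelSpace M] {F F' G : TangentBundle (𝓡 2) M → ℝ} {U s : Set M}
  {p q : M}

theorem measurableSet_chart_preimage (hs : MeasurableSet s) :
    MeasurableSet ((chartAt Plane p).target ∩ (chartAt Plane p).symm ⁻¹' s) := by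
  have := (chartAt Plane p).open_target.measurableSet.subtype_image
    ((chartAt Plane p).continuousOn_symm.domRestrict.measurable hs)
  convert this
  ext y
  simp [and_comm]

theorem chartArea_apply (hU : IsOpen U) (hs : MeasurableSet s) :
    chartArea U F p s = ∫⁻ y in (chartAt Plane p).target ∩ (chartAt Plane p).symm ⁻¹' (U ∩ s),
      holmesThompsonDensity F p y := by
  have hT : MeasurableSet ((chartAt Plane p).target ∩ (chartAt Plane p).symm ⁻¹' U) :=
    (isOpen_chart_preimage hU).measurableSet
  have hm : AEMeasurable (chartAt Plane p).symm
      (volume.restrict ((chartAt Plane p).target ∩ (chartAt Plane p).symm ⁻¹' U)) :=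
    ((chartAt Plane p).continuousOn_symm.mono inter_subset_left).aemeasurable hT
  rw [chartArea, Measure.map_apply_of_aemeasurable
    (hm.mono_ac (withDensity_absolutelyContinuous _ _)) hs, withDensity_apply',
    Measure.restrict_restrict' hT]
  congr 2
  ext y
  simp only [mem_inter_iff, mem_preimage]
  tauto

theorem chartArea_inter_source (hU : IsOpen U) (hs : MeasurableSet s) :
    chartArea U F p (s ∩ (chartAt Plane p).source) = chartArea U F p s := by
  rw [chartArea_apply hU hs,
    chartArea_apply hU (hs.inter (chartAt Plane p).open_source.measurableSet)]
  congr 2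
  ext y
  simp only [mem_inter_iff, mem_preimage]
  have := (chartAt Plane p).symm.map_source (x := y)
  simp only [OpenPartialHomeomorph.symm_source, OpenPartialHomeomorph.symm_target] at this
  tauto

/-- The area of a metric that is at most `a F` on `K` and at most
`b G` elsewhere. -/
theorem area_le_of_le {K : Set M} (hU : IsOpen U) (hK : MeasurableSet K) (hKU : K ⊆ U) {a b : ℝ}
    (ha : 0 < a) (hb : 0 < b)
    (hF : ∀ z ∈ K, ∀ v : TangentSpace (𝓡 2) z, F' ⟨z, v⟩ ≤ a * F ⟨z, v⟩)
    (hG : ∀ z ∉ K, ∀ v : TangentSpace (𝓡 2) z, F' ⟨z, v⟩ ≤ b * G ⟨z, v⟩) :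
    area univ F' ≤ ENNReal.ofReal (a ^ 2) * area U F + ENNReal.ofReal (b ^ 2) * area univ G := by
  have hdens {a : ℝ} (ha : 0 < a) {F : TangentBundle (𝓡 2) M → ℝ} (p : M) (y : Plane)
      (h : ∀ v : TangentSpace (𝓡 2) ((chartAt Plane p).symm y),
        F' ⟨(chartAt Plane p).symm y, v⟩ ≤ a * F ⟨(chartAt Plane p).symm y, v⟩) :
      holmesThompsonDensity F' p y ≤ ENNReal.ofReal (a ^ 2) * holmesThompsonDensity F p y := by
    simp only [holmesThompsonDensity_eq]
    rw [← mul_div_assoc, ← volume_codisk_mul _ ha]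
    gcongr
    exact codisk_mono fun v => h _
  -- The area is a value of a supremum of measures, so the inequality is proved between measures,
  -- chart by chart, and only then evaluated.
  suffices h : (⨆ p : M, chartArea univ F' p) ≤ ENNReal.ofReal (a ^ 2) • (⨆ p : M, chartArea U F p)
      + ENNReal.ofReal (b ^ 2) • (⨆ p : M, chartArea univ G p) by
    simpa [area] using h univ
  refine iSup_le fun p => Measure.le_iff.2 fun s hs => ?_
  have h1 : chartArea univ F' p (s ∩ K) ≤ ENNReal.ofReal (a ^ 2) * chartArea U F p s := by
    rw [chartArea_apply isOpen_univ (hs.inter hK), chartArea_apply hU hs,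
      ← lintegral_const_mul' _ _ ENNReal.ofReal_ne_top]
    have hsub : (chartAt Plane p).target ∩ (chartAt Plane p).symm ⁻¹' (univ ∩ (s ∩ K)) ⊆
        (chartAt Plane p).target ∩ (chartAt Plane p).symm ⁻¹' (U ∩ s) :=
      fun y hy => ⟨hy.1, hKU hy.2.2.2, hy.2.2.1⟩
    refine le_trans ?_ (lintegral_mono_set hsub)
    exact setLIntegral_mono' (measurableSet_chart_preimage (MeasurableSet.univ.inter (hs.inter hK)))
      fun y hy => hdens ha p y fun v => hF _ hy.2.2.2 v
  have h2 : chartArea univ F' p (s \ K) ≤ ENNReal.ofReal (b ^ 2) * chartArea univ G p s := by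
    rw [chartArea_apply isOpen_univ (hs.diff hK), chartArea_apply isOpen_univ hs,
      ← lintegral_const_mul' _ _ ENNReal.ofReal_ne_top]
    have hsub : (chartAt Plane p).target ∩ (chartAt Plane p).symm ⁻¹' (univ ∩ (s \ K)) ⊆
        (chartAt Plane p).target ∩ (chartAt Plane p).symm ⁻¹' (univ ∩ s) :=
      fun y hy => ⟨hy.1, trivial, hy.2.2.1⟩
    refine le_trans ?_ (lintegral_mono_set hsub)
    exact setLIntegral_mono' (measurableSet_chart_preimage (MeasurableSet.univ.inter (hs.diff hK)))
      fun y hy => hdens hb p y fun v => hG _ hy.2.2.2 v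
  rw [← measure_inter_add_sdiff s hK]
  simp only [Measure.add_apply, Measure.smul_apply, smul_eq_mul]
  refine (add_le_add h1 h2).trans ?_
  gcongr
  · exact (le_iSup (fun p => chartArea U F p) p)
  · exact (le_iSup (fun p => chartArea univ G p) p)

variable [IsManifold (𝓡 2) ∞ M]

/-- The Holmes-Thompson area does not depend on the chart. -/
theorem chartArea_eq_chartArea (hU : IsOpen U) (hs : MeasurableSet s)
    (hp : s ⊆ (chartAt Plane p).source) (hq : s ⊆ (chartAt Plane q).source) :
    chartArea U F p s = chartArea U F q s := by
  set A := (chartAt Plane p).target ∩ (chartAt Plane p).symm ⁻¹' (U ∩ s) with hA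
  have himage : (chartAt Plane q).target ∩ (chartAt Plane q).symm ⁻¹' (U ∩ s) =
      (fun y => chartAt Plane q ((chartAt Plane p).symm y)) '' A := by
    ext z
    constructor
    · rintro ⟨hz, hzU⟩
      have h := hp hzU.2
      refine ⟨chartAt Plane p ((chartAt Plane q).symm z), ⟨(chartAt Plane p).map_source h, ?_⟩, ?_⟩
      · rwa [mem_preimage, (chartAt Plane p).left_inv h]
      · simp only [(chartAt Plane p).left_inv h, (chartAt Plane q).right_inv hz]
    · rintro ⟨y, ⟨hy, hyU⟩, rfl⟩
      refine ⟨(chartAt Plane q).map_source (hq hyU.2), ?_⟩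
      rwa [mem_preimage, (chartAt Plane q).left_inv (hq hyU.2)]
  have hinj : InjOn (fun y => chartAt Plane q ((chartAt Plane p).symm y)) A := by
    intro y hy y' hy' h
    have h' := (chartAt Plane q).injOn (hq hy.2.2) (hq hy'.2.2) h
    rw [← (chartAt Plane p).right_inv hy.1, h', (chartAt Plane p).right_inv hy'.1]
  have hAm : MeasurableSet A := measurableSet_chart_preimage (hU.measurableSet.inter hs)
  rw [chartArea_apply hU hs, chartArea_apply hU hs, himage,
    lintegral_image_eq_lintegral_abs_det_fderiv_mul _ hAm
      (fun y hy => (hasFDerivAt_transition hy.1 (hq hy.2.2)).hasFDerivWithinAt) hinj]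
  exact setLIntegral_congr_fun hAm fun y hy =>
    holmesThompsonDensity_transition hy.1 (hq hy.2.2)

theorem area_pos (hF : IsContinuousFinslerMetric U F) (hU : IsOpen U) (hne : U.Nonempty) :
    0 < area U F := by
  obtain ⟨x, hx⟩ := hne
  obtain ⟨r, hr, c, hc, C, hC, hb, h⟩ := exists_chartMetric_bounds hF hU
    (mem_chart_target Plane x) (by simpa : (chartAt Plane x).symm (chartAt Plane x x) ∈ U)
  refine lt_of_lt_of_le ?_ (chartArea_le_area U F x univ)
  rw [chartArea_apply hU MeasurableSet.univ, inter_univ]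
  refine lt_of_lt_of_le ?_ (lintegral_mono_set hb)
  calc 0 < volume (Metric.closedBall (0 : Plane) c) / ENNReal.ofReal Real.pi *
        volume (Metric.ball (chartAt Plane x x) r) :=
        ENNReal.mul_pos (ENNReal.div_pos (Metric.measure_closedBall_pos _ _ hc).ne'
          ENNReal.ofReal_ne_top).ne' (Metric.measure_ball_pos _ _ hr).ne'
    _ = ∫⁻ _ in Metric.ball (chartAt Plane x x) r,
        volume (Metric.closedBall (0 : Plane) c) / ENNReal.ofReal Real.pi := by simp
    _ ≤ _ := setLIntegral_mono' measurableSet_ball fun y hy => by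
        rw [holmesThompsonDensity_eq]
        exact ENNReal.div_le_div_right (measure_mono (closedBall_subset_codisk
          fun v => (h y hy v).1)) _

theorem exists_open_chartArea_lt_top (hF : IsContinuousFinslerMetric U F) (hU : IsOpen U)
    {x : M} (hx : x ∈ U) :
    ∃ N, IsOpen N ∧ x ∈ N ∧ N ⊆ (chartAt Plane x).source ∧ chartArea U F x N < ⊤ := by
  obtain ⟨r, hr, c, hc, C, hC, hb, h⟩ := exists_chartMetric_bounds hF hU
    (mem_chart_target Plane x) (by simpa : (chartAt Plane x).symm (chartAt Plane x x) ∈ U)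
  have hN := (chartAt Plane x).isOpen_inter_preimage (Metric.isOpen_ball (x := chartAt Plane x x)
    (ε := r))
  refine ⟨_, hN, ⟨mem_chart_source Plane x, Metric.mem_ball_self hr⟩, inter_subset_left, ?_⟩
  rw [chartArea_apply hU hN.measurableSet]
  have hsub : (chartAt Plane x).target ∩ (chartAt Plane x).symm ⁻¹' (U ∩
      ((chartAt Plane x).source ∩ chartAt Plane x ⁻¹' Metric.ball (chartAt Plane x x) r)) ⊆
      Metric.ball (chartAt Plane x x) r := by
    rintro y ⟨hy, -, -, hy'⟩
    rwa [mem_preimage, (chartAt Plane x).right_inv hy] at hy'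
  refine (lintegral_mono_set hsub).trans_lt ?_
  calc ∫⁻ y in Metric.ball (chartAt Plane x x) r, holmesThompsonDensity F x y
      ≤ ∫⁻ _ in Metric.ball (chartAt Plane x x) r,
        volume (Metric.closedBall (0 : Plane) C) / ENNReal.ofReal Real.pi :=
        setLIntegral_mono' measurableSet_ball fun y hy => by
          rw [holmesThompsonDensity_eq]
          exact ENNReal.div_le_div_right (measure_mono (codisk_subset_closedBall hC.le
            fun v => (h y hy v).2)) _
    _ = volume (Metric.closedBall (0 : Plane) C) / ENNReal.ofReal Real.pi *
        volume (Metric.ball (chartAt Plane x x) r) := by simp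
    _ < ⊤ := ENNReal.mul_lt_top (ENNReal.div_lt_top measure_closedBall_lt_top.ne
        (ENNReal.ofReal_pos.2 Real.pi_pos).ne') measure_ball_lt_top

/-- Finitely many neighborhoods of finite chart area cover `M`. By independence of the chart, every
chart measure is dominated by the sum of these finitely many restricted measures, hence so is the
supremum. -/
theorem area_lt_top [CompactSpace M] (hF : IsContinuousFinslerMetric univ F) :
    area univ F < ⊤ := by
  choose N hNo hxN hNs hN using fun x : M => exists_open_chartArea_lt_top hF isOpen_univ
    (mem_univ x)
  obtain ⟨t, ht⟩ := isCompact_univ.elim_finite_subcover N hNo fun x _ =>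
    mem_iUnion.2 ⟨x, hxN x⟩
  have key : (⨆ p : M, chartArea univ F p) ≤
      ∑ x ∈ t, (chartArea univ F x).restrict (N x) := by
    refine iSup_le fun p => Measure.le_iff.2 fun s hs => ?_
    rw [← chartArea_inter_source isOpen_univ hs, Measure.finsetSum_apply]
    set s' := s ∩ (chartAt Plane p).source with hs'
    have hsm : MeasurableSet s' := hs.inter (chartAt Plane p).open_source.measurableSet
    have hcov : s' ⊆ ⋃ x ∈ t, s' ∩ N x := by
      intro z hz
      obtain ⟨x, hx, hzx⟩ := mem_iUnion₂.1 (ht (mem_univ z))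
      exact mem_iUnion₂.2 ⟨x, hx, hz, hzx⟩
    refine (measure_mono hcov).trans ((measure_biUnion_finset_le t _).trans ?_)
    refine Finset.sum_le_sum fun x _ => ?_
    rw [Measure.restrict_apply hs, chartArea_eq_chartArea (q := x) isOpen_univ
      (hsm.inter (hNo x).measurableSet) (inter_subset_left.trans inter_subset_right)
      (inter_subset_right.trans (hNs x))]
    exact measure_mono (inter_subset_inter_left _ inter_subset_left)
  refine (key univ).trans_lt ?_
  rw [Measure.finsetSum_apply]
  exact ENNReal.sum_lt_top.2 fun x _ => by simpa using hN x

end Area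

/-! ### Level crossings of real functions -/

section Crossing

variable {g : ℝ → ℝ} {s t r R : ℝ}

theorem exists_first_time (hst : s ≤ t) (hg : ContinuousOn g (Icc s t)) (hs : r ≤ g s)
    (ht : g t ≤ r) : ∃ b, IsLeast {u ∈ Icc s t | g u ≤ r} b ∧ g b = r := by
  have hc : IsCompact {u ∈ Icc s t | g u ≤ r} := by
    refine isCompact_Icc.of_isClosed_subset ?_ (sep_subset _ _)
    exact hg.preimage_isClosed_of_isClosed isClosed_Icc isClosed_Iic
  obtain ⟨b, hb⟩ := hc.exists_isLeast ⟨t, right_mem_Icc.2 hst, ht⟩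
  refine ⟨b, hb, ?_⟩
  obtain ⟨⟨hsb, hbt⟩, hgb⟩ := hb.1
  obtain ⟨u, hu, hgu⟩ := intermediate_value_Icc' hsb (hg.mono (Icc_subset_Icc le_rfl hbt))
    ⟨hgb, hs⟩
  obtain rfl : u = b := hu.2.antisymm (hb.2 ⟨⟨hu.1, hu.2.trans hbt⟩, hgu.le⟩)
  exact hgu

/-- A function that goes from above `R` to below `r` has a crossing between the two levels. -/
theorem exists_crossing (hst : s ≤ t) (hg : ContinuousOn g (Icc s t)) (hs : R ≤ g s)
    (ht : g t ≤ r) (hrR : r ≤ R) : ∃ a b, s ≤ a ∧ a ≤ b ∧ b ≤ t ∧ g a = R ∧ g b = r ∧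
      ∀ u ∈ Icc a b, r ≤ g u ∧ g u ≤ R := by
  obtain ⟨b, hb, hgb⟩ := exists_first_time hst hg (hrR.trans hs) ht
  have hsb := hb.1.1.1
  have hbt := hb.1.1.2
  -- The last time before `b` with value at least `R` is a first time for the function reversed in
  -- time and negated.
  have hg' : ContinuousOn (fun u => -g (-u)) (Icc (-b) (-s)) :=
    ((hg.comp continuousOn_neg fun u hu => ⟨by linarith [hu.2], by linarith [hu.1]⟩)).neg
  obtain ⟨a, ha, hga⟩ := exists_first_time (r := -R) (neg_le_neg hsb) hg'
    (by simpa [hgb]) (by simpa)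
  have has := ha.1.1.2
  have hba := ha.1.1.1
  refine ⟨-a, b, by linarith, by linarith, hbt, by linarith, hgb, fun u hu => ⟨?_, ?_⟩⟩
  · by_contra! h
    have := hb.2 ⟨⟨by linarith [hu.1], hu.2.trans hbt⟩, h.le⟩
    obtain rfl : u = b := hu.2.antisymm this
    exact h.ne hgb
  · by_contra! h
    have := ha.2 (show -u ∈ _ from ⟨⟨by linarith [hu.2], by linarith [hu.1]⟩, by simpa using h.le⟩)
    obtain rfl : u = -a := le_antisymm (by linarith) hu.1
    linarith

/-- First times of reaching decreasing levels increase with the level index. Beyond `n` the level is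
frozen at `r n`, so that the times form a full sequence. -/
theorem exists_monotone_times {r : ℕ → ℝ} (hr : Antitone r) (n : ℕ) (hst : s ≤ t)
    (hg : ContinuousOn g (Icc s t)) (hs : r 0 ≤ g s) (ht : g t ≤ r n) :
    ∃ τ : ℕ → ℝ, Monotone τ ∧ (∀ k, τ k ∈ Icc s t) ∧ ∀ k ≤ n, g (τ k) = r k := by
  have h (k : ℕ) := exists_first_time (r := r (min k n)) hst hg
    ((hr (Nat.zero_le _)).trans hs) (ht.trans (hr (min_le_right _ _)))
  choose τ hτ hgτ using h
  refine ⟨τ, fun k l hkl => ?_, fun k => (hτ k).1.1, fun k hk => by simpa [hk] using hgτ k⟩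
  exact (hτ k).2 ⟨(hτ l).1.1, (hgτ l).le.trans (hr (min_le_min_right n hkl))⟩

end Crossing

/-! ### Limits of chains of bounded length -/

section Chains

variable {X : Type*} [TopologicalSpace X] {d : X → X → ℝ≥0∞} {S : ℕ → Set X}

/-- Chains of bounded length through compact sets `S 0, …, S n` for every `n` yield an infinite
Cauchy chain. -/
theorem exists_cauchy_of_chains (htri : ∀ x y z, d x z ≤ d x y + d y z)
    (hl : ∀ k, ∀ x ∈ S k, Tendsto (fun y => d x y) (𝓝 x) (𝓝 0))
    (hr : ∀ k, ∀ x ∈ S k, Tendsto (fun y => d y x) (𝓝 x) (𝓝 0))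
    (hS : ∀ k, IsCompact (S k)) {L : ℝ≥0∞} (hL : L ≠ ⊤) (p : ℕ → ℕ → X)
    (hp : ∀ n, ∀ k ≤ n, p n k ∈ S k)
    (hsum : ∀ n, ∑ k ∈ Finset.range n, d (p n k) (p n (k + 1)) ≤ L) :
    ∃ q : ℕ → X, (∀ k, q k ∈ S k) ∧
      ∀ ε : ℝ≥0∞, 0 < ε → ∃ N, ∀ m n, N ≤ m → m ≤ n → d (q m) (q n) < ε := by
  -- A nonprincipal ultrafilter gives limits for all `k` simultaneously, in place of a diagonal
  -- extraction.
  set 𝒰 : Ultrafilter ℕ := hyperfilter ℕ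
  have h𝒰 : (𝒰 : Filter ℕ) ≤ atTop := by
    rw [← Nat.cofinite_eq_atTop]; exact hyperfilter_le_cofinite
  have hq (k : ℕ) : ∃ x ∈ S k, Tendsto (fun n => p n k) 𝒰 (𝓝 x) := by
    refine (hS k).ultrafilter_le_nhds (𝒰.map fun n => p n k) (le_principal_iff.2 ?_)
    exact h𝒰 ((eventually_ge_atTop k).mono fun n hn => hp n k hn)
  choose q hqS hq using hq
  have ha (k : ℕ) : ∃ a, Tendsto (fun n => d (p n k) (p n (k + 1))) 𝒰 (𝓝 a) := by
    obtain ⟨a, -, ha⟩ := isCompact_univ.ultrafilter_le_nhds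
      (𝒰.map fun n => d (p n k) (p n (k + 1))) (by simp)
    exact ⟨a, ha⟩
  choose a ha using ha
  -- Each partial sum of the limits is a limit of partial sums bounded by `L`.
  have hsuma : ∑' k, a k ≤ L := by
    rw [ENNReal.tsum_eq_iSup_nat]
    refine iSup_le fun N => le_of_tendsto (tendsto_finsetSum _ fun k _ => ha k) ?_
    refine h𝒰 ((eventually_ge_atTop N).mono fun n hn => ?_)
    exact (Finset.sum_le_sum_of_subset (Finset.range_mono hn)).trans (hsum n)
  -- Go from `q k` to `p n k`, then to `p n (k + 1)`, then to `q (k + 1)`; the outer terms vanish in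
  -- the limit. As `d` may be asymmetric, both `hl` and `hr` are needed.
  have hstep (k : ℕ) : d (q k) (q (k + 1)) ≤ a k := by
    have h := (((hl k _ (hqS k)).comp (hq k)).add (ha k)).add
      ((hr (k + 1) _ (hqS (k + 1))).comp (hq (k + 1)))
    simp only [zero_add, add_zero] at h
    refine ge_of_tendsto h (Eventually.of_forall fun n => ?_)
    exact (htri _ (p n (k + 1)) _).trans (add_le_add_left (htri _ _ _) _)
  have hself (k : ℕ) : d (q k) (q k) = 0 :=
    tendsto_nhds_unique (tendsto_pure_nhds (fun y => d (q k) y) (q k))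
      ((hl k _ (hqS k)).mono_left (pure_le_nhds _))
  have hdist (m j : ℕ) : d (q m) (q (m + j)) ≤ ∑ i ∈ Finset.range j, a (i + m) := by
    induction j with
    | zero => simp [hself]
    | succ j ih =>
      rw [Finset.sum_range_succ]
      refine (htri _ (q (m + j)) _).trans (add_le_add ih ?_)
      rw [add_comm j m]
      exact hstep (m + j)
  refine ⟨q, hqS, fun ε hε => ?_⟩
  have htail := ENNReal.tendsto_sum_nat_add a (ne_top_of_le_ne_top hL hsuma)
  obtain ⟨N, hN⟩ := eventually_atTop.1 (htail.eventually_lt_const hε)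
  refine ⟨N, fun m n hm hmn => ?_⟩
  obtain ⟨j, rfl⟩ := Nat.exists_eq_add_of_le hmn
  exact ((hdist m j).trans (ENNReal.sum_le_tsum _)).trans_lt (hN m hm)

end Chains

/-! ### Completeness makes the punctures far away -/

section Wall

variable {F : TangentBundle (𝓡 2) M → ℝ} {U : Set M} {ρ : M → ℝ} {r : ℕ → ℝ} {x : M}

theorem sum_lengthOn_le {γ : ℝ → M} {τ : ℕ → ℝ} (hτ : Monotone τ) {a b : ℝ}
    (hab : ∀ k, τ k ∈ Icc a b) (n : ℕ) :
    ∑ k ∈ Finset.range n, lengthOn F γ (τ k) (τ (k + 1)) ≤ lengthOn F γ a b := by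
  suffices ∀ n, ∑ k ∈ Finset.range n, lengthOn F γ (τ k) (τ (k + 1)) ≤
      lengthOn F γ (τ 0) (τ n) from
    (this n).trans (lengthOn_mono_interval (hab 0).1 (hab n).2)
  intro n
  induction n with
  | zero => simp
  | succ n ih =>
    rw [Finset.sum_range_succ, ← lengthOn_add (hτ (Nat.zero_le n)) (hτ (Nat.le_succ n))]
    gcongr

variable [IsManifold (𝓡 2) ∞ M] [CompactSpace M]

/-- In a forward complete metric, points near the end `x` of `U` are far from a given level set
of `ρ`. -/
theorem IsForwardComplete.exists_wall (hc : IsForwardComplete U F)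
    (hF : IsContinuousFinslerMetric U F) (hU : IsOpen U) (hρ : Continuous ρ)
    (hρx : ∀ y, ρ y = 0 → y = x) (hx : x ∉ U) (hr : Antitone r) (hr0 : Tendsto r atTop (𝓝 0))
    (hrU : ∀ k y, ρ y = r k → y ∈ U) {L : ℝ≥0∞} (hL : L ≠ ⊤) :
    ∃ n, ∀ y z, ρ y = r 0 → ρ z = r n → L ≤ finslerDist U F y z := by
  by_contra! h
  choose y z hy hz hlt using h
  simp only [finslerDist, iInf_lt_iff] at hlt
  choose γ hγ hlen using hlt
  -- The `n`-th short curve meets the levels `r 0, …, r n` in this order, which yields a chain of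
  -- length at most `L`.
  have hτ (n : ℕ) := exists_monotone_times hr n zero_le_one
    (g := fun t => ρ (γ n t)) (hρ.comp_continuousOn (hγ n).1.1)
    (by simp [(hγ n).2.2.1, hy]) (by simp [(hγ n).2.2.2, hz])
  choose τ hmono hmem hlev using hτ
  obtain ⟨q, hq, hcau⟩ := exists_cauchy_of_chains (S := fun k => {y | ρ y = r k})
    (finslerDist_triangle hF) (fun k x hx => tendsto_finslerDist_left hF hU (hrU k x hx))
    (fun k x hx => tendsto_finslerDist_right hF hU (hrU k x hx))
    (fun k => (isClosed_eq hρ continuous_const).isCompact) hL (fun n k => γ n (τ n k)) hlev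
    (fun n => by
      refine (Finset.sum_le_sum fun k _ => finslerDist_le_lengthOn hF (hmono n (Nat.le_succ k))
        ((SmoothPieces.of_piecewiseSmooth (hγ n).1).restrict (hmem n k).1 (hmono n (Nat.le_succ k))
          (hmem n (k + 1)).2) ((hγ n).2.1.mono_left (Icc_subset_Icc (hmem n k).1
          (hmem n (k + 1)).2))).trans ?_
      exact (sum_lengthOn_le (hmono n) (hmem n) n).trans (hlen n).le)
  -- The limit has level `lim r k = 0`, so it is the puncture `x`, which is not in `U`.
  obtain ⟨w, hw, hqw⟩ := hc q (fun n => hrU n _ (hq n)) hcau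
  have := tendsto_nhds_unique ((hρ.tendsto w).comp hqw) (hr0.congr fun k => (hq k).symm)
  exact hx (hρx w this ▸ hw)

theorem IsBackwardComplete.exists_wall (hc : IsBackwardComplete U F)
    (hF : IsContinuousFinslerMetric U F) (hU : IsOpen U) (hρ : Continuous ρ)
    (hρx : ∀ y, ρ y = 0 → y = x) (hx : x ∉ U) (hr : Antitone r) (hr0 : Tendsto r atTop (𝓝 0))
    (hrU : ∀ k y, ρ y = r k → y ∈ U) {L : ℝ≥0∞} (hL : L ≠ ⊤) :
    ∃ n, ∀ y z, ρ y = r 0 → ρ z = r n → L ≤ finslerDist U F z y := by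
  by_contra! h
  choose y z hy hz hlt using h
  simp only [finslerDist, iInf_lt_iff] at hlt
  choose γ hγ hlen using hlt
  -- The curves now leave the puncture. Reversing them could change their lengths, so only the
  -- search for the times is reversed, and the chain is measured by the transposed distance.
  have hτ (n : ℕ) := exists_monotone_times hr n (neg_le_neg (zero_le_one' ℝ))
    (g := fun t => ρ (γ n (-t))) (hρ.comp_continuousOn ((hγ n).1.1.comp continuousOn_neg
      fun u hu => ⟨by linarith [hu.2], by linarith [hu.1]⟩))
    (by simp [(hγ n).2.2.2, hy]) (by simp [(hγ n).2.2.1, hz])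
  choose τ hmono hmem hlev using hτ
  have hmem' (n k) : -τ n k ∈ Icc (0 : ℝ) 1 :=
    ⟨by linarith [(hmem n k).2], by linarith [(hmem n k).1]⟩
  obtain ⟨q, hq, hcau⟩ := exists_cauchy_of_chains (S := fun k => {y | ρ y = r k})
    (d := fun x y => finslerDist U F y x)
    (fun x y z => (finslerDist_triangle hF z y x).trans_eq (add_comm _ _))
    (fun k x hx => tendsto_finslerDist_right hF hU (hrU k x hx))
    (fun k x hx => tendsto_finslerDist_left hF hU (hrU k x hx))
    (fun k => (isClosed_eq hρ continuous_const).isCompact) hL (fun n k => γ n (-τ n k)) hlev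
    (fun n => by
      have hle (k : ℕ) : -τ n (k + 1) ≤ -τ n k := neg_le_neg (hmono n (Nat.le_succ k))
      refine (Finset.sum_le_sum fun k _ => finslerDist_le_lengthOn hF (hle k)
        ((SmoothPieces.of_piecewiseSmooth (hγ n).1).restrict (hmem' n (k + 1)).1 (hle k)
          (hmem' n k).2) ((hγ n).2.1.mono_left (Icc_subset_Icc (hmem' n (k + 1)).1
          (hmem' n k).2))).trans ?_
      refine le_trans ?_ (hlen n).le
      -- Summing in the opposite order makes the times `-τ n (n - k)` increase with `k`.
      rw [← Finset.sum_range_reflect]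
      have hmono' : Monotone fun k => -τ n (n - k) := fun k l hkl =>
        neg_le_neg (hmono n (Nat.sub_le_sub_left hkl n))
      refine le_trans (Finset.sum_le_sum fun k hk => ?_)
        (sum_lengthOn_le hmono' (fun k => hmem' n (n - k)) n)
      rw [Finset.mem_range] at hk
      rw [show n - 1 - k + 1 = n - k by omega, show n - 1 - k = n - (k + 1) by omega])
  obtain ⟨w, hw, hqw⟩ := hc q (fun n => hrU n _ (hq n)) hcau
  have := tendsto_nhds_unique ((hρ.tendsto w).comp hqw) (hr0.congr fun k => (hq k).symm)
  exact hx (hρx w this ▸ hw)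

end Wall

/-! ### The auxiliary metric induced by an embedding -/

section InducedMetric

variable {n : ℕ} {e : M → EuclideanSpace ℝ (Fin n)}

/-- The derivative of a map to a Euclidean space, on the tangent bundle. -/
def ambientDeriv (e : M → EuclideanSpace ℝ (Fin n)) (v : TangentBundle (𝓡 2) M) :
    EuclideanSpace ℝ (Fin n) :=
  mfderiv (𝓡 2) 𝓘(ℝ, EuclideanSpace ℝ (Fin n)) e v.proj v.snd

/-- The derivative at a point of a map to a Euclidean space, as a linear map. -/
def ambientDerivₗ (e : M → EuclideanSpace ℝ (Fin n)) (x : M) :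
    TangentSpace (𝓡 2) x →ₗ[ℝ] EuclideanSpace ℝ (Fin n) :=
  (mfderiv (𝓡 2) 𝓘(ℝ, EuclideanSpace ℝ (Fin n)) e x).toLinearMap

/-- The Riemannian metric induced by a map to a Euclidean space. -/
def inducedMetric (e : M → EuclideanSpace ℝ (Fin n)) (v : TangentBundle (𝓡 2) M) : ℝ :=
  ‖ambientDeriv e v‖

theorem inducedMetric_apply (x : M) (u : TangentSpace (𝓡 2) x) :
    inducedMetric e ⟨x, u⟩ = ‖ambientDerivₗ e x u‖ := rfl

/-- A Riemannian metric belongs to all three categories, so a single auxiliary metric serves in each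
case. -/
theorem holds_inducedMetric (κ : MetricKind) : κ.Holds univ (inducedMetric e) := by
  cases κ with
  | riemannian =>
    intro x _
    refine ⟨(innerₗ (EuclideanSpace ℝ (Fin n))).compl₁₂ (ambientDerivₗ e x) (ambientDerivₗ e x),
      fun u v => ?_, fun u => ?_⟩
    · exact real_inner_comm (ambientDerivₗ e x v) (ambientDerivₗ e x u)
    · rw [inducedMetric_apply]
      exact (real_inner_self_eq_norm_sq (ambientDerivₗ e x u)).symm
  | reversibleFinsler =>
    intro x _ u
    rw [inducedMetric_apply, inducedMetric_apply, map_neg, norm_neg]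
  | finsler => trivial

variable [IsManifold (𝓡 2) ∞ M]

theorem isFinslerMetric_inducedMetric
    (he : ContMDiff (𝓡 2) 𝓘(ℝ, EuclideanSpace ℝ (Fin n)) ∞ e)
    (hinj : ∀ x, Function.Injective (mfderiv (𝓡 2) 𝓘(ℝ, EuclideanSpace ℝ (Fin n)) e x)) :
    IsFinslerMetric univ (inducedMetric e) := by
  have hT : ContMDiff (𝓡 2).tangent 𝓘(ℝ, EuclideanSpace ℝ (Fin n)) ∞ (ambientDeriv e) :=
    (contMDiff_snd_tangentBundle_modelSpace (EuclideanSpace ℝ (Fin n))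
      𝓘(ℝ, EuclideanSpace ℝ (Fin n))).comp (he.contMDiff_tangentMap (m := ∞) (by simp))
  have hne (x : M) (u : TangentSpace (𝓡 2) x) (hu : u ≠ 0) : ambientDerivₗ e x u ≠ 0 :=
    fun h => hu (hinj x (h.trans (map_zero (ambientDerivₗ e x)).symm))
  refine ⟨⟨hT.continuous.norm.continuousOn, fun x _ u v => ?_, fun x _ t ht u => ?_,
    fun x _ u hu => norm_pos_iff.2 (hne x u hu)⟩, fun v hv => ?_⟩
  · simp only [inducedMetric_apply, map_add]
    exact norm_add_le _ _
  · simp only [inducedMetric_apply, map_smul]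
    rw [norm_smul, Real.norm_of_nonneg ht]
  · have h : ContMDiffAt 𝓘(ℝ, EuclideanSpace ℝ (Fin n)) 𝓘(ℝ, ℝ) ∞ norm (ambientDeriv e v) :=
      (contDiffAt_norm ℝ (hne _ _ hv.2)).contMDiffAt
    exact (h.comp v (hT v)).contMDiffWithinAt

end InducedMetric

/-! ### Cutting off the metric near the punctures -/

section CutoffMetric

variable {U : Set M} {F G : TangentBundle (𝓡 2) M → ℝ} {χ : M → ℝ} {δ : ℝ}

/-- The metric `F`, cut off by the function `χ` and completed by a multiple of `G`. -/
def cutoffMetric (χ : M → ℝ) (δ : ℝ) (F G : TangentBundle (𝓡 2) M → ℝ)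
    (v : TangentBundle (𝓡 2) M) : ℝ :=
  √((χ v.proj * F v) ^ 2 + (δ * G v) ^ 2)

theorem sqrt_add_sq_le (a b c d : ℝ) :
    √((a + b) ^ 2 + (c + d) ^ 2) ≤ √(a ^ 2 + c ^ 2) + √(b ^ 2 + d ^ 2) := by
  have h := norm_add_le (!₂[a, c] : EuclideanSpace ℝ (Fin 2)) !₂[b, d]
  simpa [EuclideanSpace.norm_eq, Fin.sum_univ_two] using h

/-- This is why squares are added rather than the metrics themselves: a sum of two quadratic forms
is a quadratic form. -/
theorem holds_cutoffMetric {κ : MetricKind} (hF : κ.Holds U F) (hG : κ.Holds univ G)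
    (hχU : ∀ x ∉ U, χ x = 0) : κ.Holds univ (cutoffMetric χ δ F G) := by
  cases κ with
  | riemannian =>
    intro x _
    obtain ⟨B, hB, hBG⟩ := hG x trivial
    obtain ⟨B', hB', hBF⟩ : ∃ B' : LinearMap.BilinForm ℝ (TangentSpace (𝓡 2) x),
        (∀ u v, B' u v = B' v u) ∧ ∀ u : TangentSpace (𝓡 2) x, (χ x * F ⟨x, u⟩) ^ 2 = B' u u := by
      by_cases hx : x ∈ U
      · obtain ⟨B', hB', h⟩ := hF x hx
        refine ⟨χ x ^ 2 • B', fun u v => ?_, fun u => ?_⟩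
        · simp [hB' u v]
        · simp [mul_pow, h u]
      · exact ⟨0, by simp, by simp [hχU x hx]⟩
    refine ⟨B' + δ ^ 2 • B, fun u v => ?_, fun u => ?_⟩
    · simp [hB u v, hB' u v]
    · simp only [cutoffMetric]
      rw [Real.sq_sqrt (by positivity), hBF, mul_pow, hBG]
      simp
  | reversibleFinsler =>
    intro x _ u
    have h : χ x * F ⟨x, -u⟩ = χ x * F ⟨x, u⟩ := by
      by_cases hx : x ∈ U
      · rw [hF x hx u]
      · simp [hχU x hx]
    simp only [cutoffMetric, h, hG x trivial u]
  | finsler => trivial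

theorem le_cutoffMetric {x : M} (hx : χ x = 1) (v : TangentSpace (𝓡 2) x) :
    F ⟨x, v⟩ ≤ cutoffMetric χ δ F G ⟨x, v⟩ := by
  refine Real.le_sqrt_of_sq_le ?_
  simp only [hx, one_mul]
  linarith [sq_nonneg (δ * G ⟨x, v⟩)]

variable [IsManifold (𝓡 2) ∞ M]

/-- The term `δ G` keeps the radicand positive on nonzero vectors, where the square root is
therefore smooth. Near points outside `U` the first term vanishes identically, so the values of `F`
there do not matter. -/
theorem isFinslerMetric_cutoffMetric (hF : IsFinslerMetric U F) (hG : IsFinslerMetric univ G)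
    (hU : IsOpen U) (hχ : ContMDiff (𝓡 2) 𝓘(ℝ, ℝ) ∞ χ) (hχ0 : ∀ x, 0 ≤ χ x)
    (hχU : ∀ x ∉ U, ∀ᶠ y in 𝓝 x, χ y = 0) (hδ : 0 < δ) :
    IsFinslerMetric univ (cutoffMetric χ δ F G) := by
  have hproj : Continuous fun v : TangentBundle (𝓡 2) M => v.proj :=
    FiberBundle.continuous_proj Plane (TangentSpace (𝓡 2) : M → Type _)
  have hprojs : ContMDiff (𝓡 2).tangent (𝓡 2) ∞ fun v : TangentBundle (𝓡 2) M => v.proj :=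
    Bundle.contMDiff_proj (TangentSpace (𝓡 2) : M → Type _)
  have hUo : IsOpen {v : TangentBundle (𝓡 2) M | v.proj ∈ U} := hU.preimage hproj
  have hzero (v : TangentBundle (𝓡 2) M) (hv : v.proj ∉ U) :
      (fun v => χ v.proj * F v) =ᶠ[𝓝 v] fun _ => 0 := by
    filter_upwards [hproj.continuousAt.eventually (hχU _ hv)] with w hw
    rw [hw, zero_mul]
  have hχz (x : M) (hx : x ∉ U) : χ x = 0 := (hχU x hx).self_of_nhds
  have hcont : Continuous fun v => χ v.proj * F v := by
    refine continuous_iff_continuousAt.2 fun v => ?_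
    by_cases hv : v.proj ∈ U
    · exact (hχ.continuous.comp hproj).continuousAt.mul
        (hF.continuousOn.continuousAt (hUo.mem_nhds hv))
    · exact continuousAt_const.congr (hzero v hv).symm
  have hsub (x : M) (u v : TangentSpace (𝓡 2) x) :
      χ x * F ⟨x, u + v⟩ ≤ χ x * F ⟨x, u⟩ + χ x * F ⟨x, v⟩ := by
    by_cases hx : x ∈ U
    · rw [← mul_add]
      exact mul_le_mul_of_nonneg_left (hF.subadditive x hx u v) (hχ0 x)
    · simp [hχz x hx]
  have hnonneg (x : M) (u : TangentSpace (𝓡 2) x) : 0 ≤ χ x * F ⟨x, u⟩ := by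
    by_cases hx : x ∈ U
    · exact mul_nonneg (hχ0 x) (hF.nonneg hx u)
    · simp [hχz x hx]
  have hGpos (x : M) (u : TangentSpace (𝓡 2) x) (hu : u ≠ 0) : 0 < δ * G ⟨x, u⟩ :=
    mul_pos hδ (hG.pos x trivial u hu)
  refine ⟨⟨?_, fun x _ u v => ?_, fun x _ t ht u => ?_, fun x _ u hu => ?_⟩, fun v hv => ?_⟩
  · have hGc : Continuous G := by simpa [← continuousOn_univ] using hG.continuousOn
    exact ((hcont.pow 2).add ((continuous_const.mul hGc).pow 2)).sqrt.continuousOn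
  · refine le_trans (Real.sqrt_le_sqrt ?_) (sqrt_add_sq_le _ _ _ _)
    have h1 := hG.nonneg (mem_univ x) (u + v)
    have h2 := hG.subadditive x trivial u v
    have h3 : δ * G ⟨x, u + v⟩ ≤ δ * G ⟨x, u⟩ + δ * G ⟨x, v⟩ := by
      rw [← mul_add]; gcongr
    exact add_le_add (pow_le_pow_left₀ (hnonneg x _) (hsub x u v) 2)
      (pow_le_pow_left₀ (by positivity) h3 2)
  · have h1 : χ x * F ⟨x, t • u⟩ = t * (χ x * F ⟨x, u⟩) := by
      by_cases hx : x ∈ U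
      · rw [hF.homogeneous x hx t ht u]; ring
      · simp [hχz x hx]
    simp only [cutoffMetric, h1, hG.homogeneous x trivial t ht u]
    rw [show (t * (χ x * F ⟨x, u⟩)) ^ 2 + (δ * (t * G ⟨x, u⟩)) ^ 2 =
      t ^ 2 * ((χ x * F ⟨x, u⟩) ^ 2 + (δ * G ⟨x, u⟩) ^ 2) by ring,
      Real.sqrt_mul (sq_nonneg t), Real.sqrt_sq ht]
  · have := hGpos x u hu
    exact Real.sqrt_pos.2 (by positivity)
  · have hGv : ContMDiffWithinAt (𝓡 2).tangent 𝓘(ℝ, ℝ) ∞ G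
        {v | v.proj ∈ univ ∧ v.snd ≠ 0} v := hG.contMDiffOn v hv
    have hFv : ContMDiffWithinAt (𝓡 2).tangent 𝓘(ℝ, ℝ) ∞ (fun v => χ v.proj * F v)
        {v : TangentBundle (𝓡 2) M | v.proj ∈ univ ∧ v.snd ≠ 0} v := by
      by_cases hvU : v.proj ∈ U
      · have hFv := (hF.contMDiffOn v ⟨hvU, hv.2⟩).mono_of_mem_nhdsWithin
          (t := {v : TangentBundle (𝓡 2) M | v.proj ∈ univ ∧ v.snd ≠ 0}) (by
            filter_upwards [self_mem_nhdsWithin, mem_nhdsWithin_of_mem_nhds (hUo.mem_nhds hvU)]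
              with w hw hwU using ⟨hwU, hw.2⟩)
        exact ((hχ.comp hprojs) v).contMDiffWithinAt.mul hFv
      · exact contMDiffWithinAt_const.congr_of_eventuallyEq
          ((hzero v hvU).filter_mono nhdsWithin_le_nhds) (hzero v hvU).self_of_nhds
    have hpos := hGpos v.proj v.snd hv.2
    have hsqrt : ContDiffAt ℝ ∞ Real.sqrt ((χ v.proj * F v) ^ 2 + (δ * G v) ^ 2) := by
      refine Real.contDiffAt_sqrt (ne_of_gt ?_)
      have : 0 < (δ * G v) ^ 2 := pow_pos hpos 2
      positivity
    exact hsqrt.contMDiffAt.comp_contMDiffWithinAt v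
      ((hFv.pow 2).add ((contMDiffWithinAt_const.mul hGv).pow 2))

end CutoffMetric

theorem loopCurve_add_one {M : Type*} [TopologicalSpace M] {V : Set M} (γ : C(UnitAddCircle, V)) (t : ℝ) :
    loopCurve γ (t + 1) = loopCurve γ t := by
  unfold loopCurve
  rw [AddCircle.coe_add_period]

/-! ### Contractible loops -/

section Homotopy

theorem nullhomotopic_of_subset_chart {Y : Type*} [TopologicalSpace Y] {V : Set M} {p : M}
    {B : Set Plane} (hB : Convex ℝ B) (hBne : B.Nonempty) (hBt : B ⊆ (chartAt Plane p).target)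
    (hBV : ∀ y ∈ B, (chartAt Plane p).symm y ∈ V) (γ : C(Y, V))
    (hγ : ∀ t, ∃ y ∈ B, (chartAt Plane p).symm y = (γ t : M)) : γ.Nullhomotopic := by
  have hs (t : Y) : (γ t : M) ∈ (chartAt Plane p).source ∧ chartAt Plane p (γ t) ∈ B := by
    obtain ⟨y, hy, h⟩ := hγ t
    rw [← h, (chartAt Plane p).right_inv (hBt hy)]
    exact ⟨(chartAt Plane p).map_target (hBt hy), hy⟩
  let f : C(Y, B) := ⟨fun t => ⟨chartAt Plane p (γ t), (hs t).2⟩,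
    ((chartAt Plane p).continuousOn.comp_continuous (by fun_prop) fun t => (hs t).1).subtype_mk _⟩
  let g : C(B, V) := ⟨fun y => ⟨(chartAt Plane p).symm y, hBV y y.2⟩,
    ((chartAt Plane p).continuousOn_symm.comp_continuous continuous_subtype_val
      fun y => hBt y.2).subtype_mk _⟩
  have hfg : γ = g.comp ((ContinuousMap.id B).comp f) := by
    ext t
    exact ((chartAt Plane p).left_inv (hs t).1).symm
  have := hB.contractibleSpace hBne
  rw [hfg]
  exact ((id_nullhomotopic B).comp_left f).comp_right g

theorem exists_Ico_coe_eq (z : UnitAddCircle) : ∃ t ∈ Ico (0 : ℝ) 1, (t : UnitAddCircle) = z := by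
  obtain ⟨t, ht, h⟩ := (AddCircle.coe_image_Ico_eq (1 : ℝ) 0).symm ▸ mem_univ z
  exact ⟨t, by simpa using ht, h⟩

/-- A cusp loop becomes contractible after filling in the puncture. -/
theorem IsCuspLoopMultiple.nullhomotopic {P : Finset M} {x : M}
    {δ : C(UnitAddCircle, ((P : Set M)ᶜ : Set M))} (h : IsCuspLoopMultiple P x δ)
    (i : C(((P : Set M)ᶜ : Set M), (univ : Set M))) (hi : ∀ z, (i z : M) = z) :
    (i.comp δ).Nullhomotopic := by
  obtain ⟨r, m, hr, hball, -, h⟩ := h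
  refine nullhomotopic_of_subset_chart (convex_closedBall _ _)
    (Metric.nonempty_closedBall.2 hr.le) hball (fun _ _ => mem_univ _) _ fun z => ?_
  obtain ⟨t, -, rfl⟩ := exists_Ico_coe_eq z
  refine ⟨_, ?_, (h t).symm.trans (hi _).symm⟩
  rw [Metric.mem_closedBall, dist_self_add_left, norm_smul, Real.norm_of_nonneg hr.le,
    EuclideanSpace.norm_eq]
  simp

/-- `ε` is a Lebesgue number of a cover of the embedded surface by chart balls, in each of which
loops contract. -/
theorem exists_uniform_nullhomotopic [CompactSpace M] {n : ℕ} {e : M → EuclideanSpace ℝ (Fin n)}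
    (he : IsClosedEmbedding e) :
    ∃ ε > 0, ∀ x : M, ∀ γ : C(UnitAddCircle, (univ : Set M)),
      (∀ t, ‖e (γ t) - e x‖ < ε) → γ.Nullhomotopic := by
  have h (x : M) : ∃ r > 0, Metric.ball (chartAt Plane x x) r ⊆ (chartAt Plane x).target :=
    Metric.isOpen_iff.1 (chartAt Plane x).open_target _ (mem_chart_target Plane x)
  choose r hr hball using h
  have ho (x : M) := (he.isInducing.isOpen_iff.1 ((chartAt Plane x).isOpen_inter_preimage
    (Metric.isOpen_ball (x := chartAt Plane x x) (ε := r x))))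
  choose c hc hcx using ho
  obtain ⟨ε, hε, h⟩ := lebesgue_number_lemma_of_metric (isCompact_range he.continuous) hc (by
    rintro _ ⟨x, rfl⟩
    refine mem_iUnion.2 ⟨x, ?_⟩
    have : x ∈ e ⁻¹' c x := by
      rw [hcx]
      exact ⟨mem_chart_source Plane x, Metric.mem_ball_self (hr x)⟩
    exact this)
  refine ⟨ε, hε, fun x γ hγ => ?_⟩
  obtain ⟨p, hp⟩ := h (e x) ⟨x, rfl⟩
  refine nullhomotopic_of_subset_chart (convex_ball _ _) (Metric.nonempty_ball.2 (hr p)) (hball p)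
    (fun _ _ => mem_univ _) γ fun t => ?_
  have : (γ t : M) ∈ e ⁻¹' c p := hp (by rw [Metric.mem_ball, dist_eq_norm]; exact hγ t)
  rw [hcx] at this
  exact ⟨_, this.2, (chartAt Plane p).left_inv this.1⟩

end Homotopy

/-! ### Systole of the cut-off metric -/

section Systole

variable {n : ℕ} {e : M → EuclideanSpace ℝ (Fin n)}

theorem edist_le_lengthOn_inducedMetric (he : ContMDiff (𝓡 2) 𝓘(ℝ, EuclideanSpace ℝ (Fin n)) ∞ e)
    {γ : ℝ → M} {a b : ℝ} (h : SmoothPieces γ a b) :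
    edist (e (γ a)) (e (γ b)) ≤ lengthOn (inducedMetric e) γ a b := by
  induction h with
  | refl => simp
  | @step b c h hbc hs ih =>
    rw [← lengthOn_add h.le hbc]
    refine (edist_triangle _ (e (γ b)) _).trans (add_le_add ih ?_)
    have hcomp : ContDiffOn ℝ 1 (fun t => e (γ t)) (Icc b c) :=
      ((he.contMDiffOn (s := univ)).comp hs fun _ _ => trivial).contDiffOn.of_le (by simp)
    rw [edist_comm, edist_eq_enorm_sub]
    refine (enorm_sub_le_lintegral_deriv_of_contDiffOn_Icc hcomp hbc).trans_eq ?_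
    unfold lengthOn
    rw [← restrict_Ioo_eq_restrict_Icc]
    refine setLIntegral_congr_fun measurableSet_Ioo fun t ht => ?_
    have hγ : MDifferentiableAt 𝓘(ℝ, ℝ) (𝓡 2) γ t :=
      (hs.contMDiffAt (Icc_mem_nhds ht.1 ht.2)).mdifferentiableAt (by simp)
    obtain ⟨A, hA, hA1⟩ : ∃ A : ℝ →L[ℝ] EuclideanSpace ℝ (Fin n),
        HasFDerivAt (fun t => e (γ t)) A t ∧
          A 1 = ambientDeriv e ⟨γ t, mfderiv 𝓘(ℝ, ℝ) (𝓡 2) γ t (1 : ℝ)⟩ :=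
      ⟨_, ((he.mdifferentiableAt (by simp)).hasMFDerivAt.comp t hγ.hasMFDerivAt).hasFDerivAt, rfl⟩
    have := hA.hasDerivAt.deriv.trans hA1
    rw [this, inducedMetric, ofReal_norm]

/-- The systole of the metric induced by an embedding is positive. -/
theorem systole_inducedMetric_pos [CompactSpace M]
    (he : ContMDiff (𝓡 2) 𝓘(ℝ, EuclideanSpace ℝ (Fin n)) ∞ e) (hemb : IsClosedEmbedding e) :
    0 < systole univ (inducedMetric e) := by
  obtain ⟨ε, hε, h⟩ := exists_uniform_nullhomotopic hemb
  refine (ENNReal.ofReal_pos.2 hε).trans_le (le_iInf₂ fun γ hγ => ?_)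
  by_contra! hlt
  refine hγ.2 (h (loopCurve γ 0) γ fun z => ?_)
  obtain ⟨t, ht, rfl⟩ := exists_Ico_coe_eq z
  have hs := (SmoothPieces.of_piecewiseSmooth hγ.1).restrict le_rfl ht.1 ht.2.le
  have := ((edist_le_lengthOn_inducedMetric he hs).trans
    (lengthOn_mono_interval le_rfl ht.2.le)).trans_lt hlt
  rw [edist_comm, edist_dist, ENNReal.ofReal_lt_ofReal_iff hε, dist_eq_norm] at this
  exact this

section Periodic

variable {c : ℝ → M} {s : ℝ}

theorem SmoothPieces.periodic (h : SmoothPieces c 0 1) (hc : ∀ t, c (t + 1) = c t)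
    (hs : s ∈ Icc (0 : ℝ) 1) : SmoothPieces c s (s + 1) := by
  have h1 := h.comp_affine (k := 1) (s := -1) one_pos
  have h2 : SmoothPieces c 1 2 := by
    norm_num at h1
    refine h1.congr fun t _ => ?_
    change c t = c (t + -1)
    rw [← hc (t + -1), neg_add_cancel_right]
  exact (h.trans h2).restrict hs.1 (by linarith) (by linarith [hs.2])

theorem lengthOn_periodic (F : TangentBundle (𝓡 2) M → ℝ) (hc : ∀ t, c (t + 1) = c t)
    (hs : s ∈ Icc (0 : ℝ) 1) : lengthOn F c s (s + 1) = lengthOn F c 0 1 := by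
  rw [← lengthOn_add hs.2 (by linarith [hs.1] : 1 ≤ s + 1), ← lengthOn_add hs.1 hs.2, add_comm]
  congr 1
  have h := lengthOn_comp_add (F := F) (γ := c) (a := 0) (b := s) 1
  rw [zero_add, funext hc] at h
  exact h.symm

end Periodic

variable [IsManifold (𝓡 2) ∞ M] [T2Space M] [CompactSpace M]

/-- For a complete metric `F` on the punctured surface, there is a cutoff function such that every
metric of the closed surface that is at least `F` where the function is `1` has a systole that is
at least a given bound below the marked systole of `F`. -/
theorem exists_cutoff_le_systole {P : Finset M} {F : TangentBundle (𝓡 2) M → ℝ}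
    (he : ContMDiff (𝓡 2) 𝓘(ℝ, EuclideanSpace ℝ (Fin n)) ∞ e) (hemb : IsClosedEmbedding e)
    (hF : IsContinuousFinslerMetric (P : Set M)ᶜ F)
    (hcomplete : IsForwardComplete (P : Set M)ᶜ F ∨ IsBackwardComplete (P : Set M)ᶜ F)
    {L : ℝ≥0∞} (hL : L < markedSystole P F) :
    ∃ (χ : M → ℝ) (K : Set M), ContMDiff (𝓡 2) 𝓘(ℝ, ℝ) ∞ χ ∧ (∀ x, 0 ≤ χ x ∧ χ x ≤ 1) ∧
      IsClosed K ∧ K ⊆ (P : Set M)ᶜ ∧ (∀ x ∉ K, χ x = 0) ∧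
      ∀ F' : TangentBundle (𝓡 2) M → ℝ,
        (∀ x, χ x = 1 → ∀ v : TangentSpace (𝓡 2) x, F ⟨x, v⟩ ≤ F' ⟨x, v⟩) →
        L ≤ systole univ F' := by
  have hU : IsOpen (P : Set M)ᶜ := P.finite_toSet.isClosed.isOpen_compl
  obtain ⟨ε, hε, hnull⟩ := exists_uniform_nullhomotopic hemb
  -- `R < ε` makes loops within `R` of a puncture contractible, and `2 * R` separates the disks of
  -- radius `R` around distinct punctures.
  obtain ⟨R, hRε, hRP, hR⟩ : ∃ R : ℝ, R < ε ∧
      (∀ x ∈ P, ∀ y ∈ P, x ≠ y → 2 * R ≤ ‖e x - e y‖) ∧ 0 < R := by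
    have h1 : ∀ᶠ R : ℝ in 𝓝[>] 0, R < ε :=
      mem_nhdsWithin_of_mem_nhds (Iio_mem_nhds hε)
    have h2 : ∀ᶠ R : ℝ in 𝓝[>] 0, ∀ x ∈ P, ∀ y ∈ P, x ≠ y → 2 * R ≤ ‖e x - e y‖ := by
      rw [eventually_all_finset]
      intro x _
      rw [eventually_all_finset]
      intro y _
      by_cases hxy : x = y
      · simp [hxy]
      have hpos : 0 < ‖e x - e y‖ / 2 := by
        have := norm_pos_iff.2 (sub_ne_zero.2 (hemb.injective.ne hxy))
        positivity
      filter_upwards [mem_nhdsWithin_of_mem_nhds (Iio_mem_nhds hpos)] with R hR _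
      rw [mem_Iio] at hR
      linarith
    exact (h1.and (h2.and self_mem_nhdsWithin)).exists
  set ρ : M → M → ℝ := fun x y => ‖e y - e x‖ with hρ
  have hρc (x : M) : Continuous (ρ x) := (he.continuous.sub continuous_const).norm
  have hρ0 (x y : M) (h : ρ x y = 0) : y = x :=
    hemb.injective (sub_eq_zero.1 (norm_eq_zero.1 h))
  have hfar (x y z : M) (hx : x ∈ P) (hz : z ∈ P) (hxz : z ≠ x) (hy : ρ x y ≤ R) : R ≤ ρ z y := by
    have h1 := hRP x hx z hz hxz.symm
    have h2 := norm_sub_le_norm_sub_add_norm_sub (e x) (e y) (e z)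
    rw [norm_sub_rev (e x) (e y)] at h2
    simp only [hρ] at hy ⊢
    linarith
  set r : ℕ → ℝ := fun k => R * (1 / 2) ^ k with hr
  have hrpos (k : ℕ) : 0 < r k := by positivity
  have hrR (k : ℕ) : r k ≤ R :=
    mul_le_of_le_one_right hR.le (pow_le_one₀ (by norm_num) (by norm_num))
  have hr0 : r 0 = R := by simp [hr]
  have hanti : Antitone r := fun k l hkl =>
    mul_le_mul_of_nonneg_left (pow_le_pow_of_le_one (by norm_num) (by norm_num) hkl) hR.le
  have hlim : Tendsto r atTop (𝓝 0) := by
    have := (tendsto_pow_atTop_nhds_zero_of_lt_one (r := (1 / 2 : ℝ)) (by norm_num)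
      (by norm_num)).const_mul R
    rwa [mul_zero] at this
  have hrU (x : M) (hx : x ∈ P) (k : ℕ) (y : M) (hy : ρ x y = r k) : y ∈ (P : Set M)ᶜ := by
    intro hyP
    rcases eq_or_ne y x with rfl | hne
    · simp only [hρ, sub_self, norm_zero] at hy
      exact (hrpos k).ne hy
    · have := hfar x y y hx hyP hne (hy.le.trans (hrR k))
      simp only [hρ, sub_self, norm_zero] at this
      linarith
  have hwall (x : M) : ∃ k, x ∈ P →
      (∀ y z, ρ x y = R → ρ x z = r k → L ≤ finslerDist (P : Set M)ᶜ F y z) ∨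
      (∀ y z, ρ x y = R → ρ x z = r k → L ≤ finslerDist (P : Set M)ᶜ F z y) := by
    by_cases hx : x ∈ P
    · have hx' : x ∉ (P : Set M)ᶜ := fun h => h hx
      rcases hcomplete with hc | hc
      · obtain ⟨k, hk⟩ := hc.exists_wall hF hU (hρc x) (hρ0 x) hx' hanti hlim (hrU x hx) hL.ne_top
        exact ⟨k, fun _ => Or.inl (by simpa only [hr0] using hk)⟩
      · obtain ⟨k, hk⟩ := hc.exists_wall hF hU (hρc x) (hρ0 x) hx' hanti hlim (hrU x hx) hL.ne_top
        exact ⟨k, fun _ => Or.inr (by simpa only [hr0] using hk)⟩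
    · exact ⟨0, fun h => absurd h hx⟩
  choose k hk using hwall
  -- `χ` will be 1 on `K₁` and 0 off `K`. The factor 1/2 leaves a gap in which to interpolate.
  set K₁ : Set M := {y | ∀ x ∈ P, r (k x) ≤ ρ x y} with hK₁
  set K : Set M := {y | ∀ x ∈ P, r (k x) / 2 ≤ ρ x y} with hK
  have hK₁c : IsClosed K₁ := by
    simp only [hK₁, ofPred_forall]
    exact isClosed_biInter fun x _ => isClosed_le continuous_const (hρc x)
  have hKc : IsClosed K := by
    simp only [hK, ofPred_forall]
    exact isClosed_biInter fun x _ => isClosed_le continuous_const (hρc x)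
  set Z : Set M := ⋃ x ∈ P, {y | ρ x y ≤ r (k x) / 2} with hZ
  have hZc : IsClosed Z := P.finite_toSet.isClosed_biUnion fun x _ =>
    isClosed_le (hρc x) continuous_const
  have hdisj : Disjoint Z K₁ := by
    refine disjoint_left.2 fun y hy hy' => ?_
    obtain ⟨x, hx, hxy⟩ := mem_iUnion₂.1 hy
    have h1 := hy' x hx
    have h2 := hrpos (k x)
    rw [mem_ofPred_eq] at hxy
    linarith
  obtain ⟨χ, hχs, hχr, hχ0, hχ1⟩ :=
    exists_contMDiff_zero_iff_one_iff_of_isClosed (𝓡 2) (n := (⊤ : ℕ∞)) hZc hK₁c hdisj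
  have hK₁U : K₁ ⊆ (P : Set M)ᶜ := by
    intro y hy hyP
    have := hy y hyP
    simp only [hρ, sub_self, norm_zero] at this
    linarith [hrpos (k y)]
  refine ⟨χ, K, hχs, fun x => hχr ⟨x, rfl⟩, hKc, ?_, fun x hx => ?_, fun F' hF' => ?_⟩
  · intro y hy hyP
    have := hy y hyP
    simp only [hρ, sub_self, norm_zero] at this
    linarith [hrpos (k y)]
  · rw [← hχ0]
    simp only [hK, mem_ofPred_eq, not_forall, not_le] at hx
    obtain ⟨z, hz, h⟩ := hx
    exact mem_iUnion₂.2 ⟨z, hz, h.le⟩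
  refine le_iInf₂ fun γ hγ => ?_
  by_contra! hlt
  set c := loopCurve γ with hc
  have hper : ∀ t, c (t + 1) = c t := loopCurve_add_one γ
  have hcs := SmoothPieces.of_piecewiseSmooth hγ.1
  have hle {a b : ℝ} (h : ∀ t ∈ Icc a b, c t ∈ K₁) : lengthOn F c a b ≤ lengthOn F' c a b :=
    lengthOn_mono_metric fun t ht => hF' _ ((hχ1 _).1 (h t ht))
  have hcγ (z : UnitAddCircle) : ∃ t ∈ Ico (0 : ℝ) 1, c t = γ z := by
    obtain ⟨t, ht, rfl⟩ := exists_Ico_coe_eq z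
    exact ⟨t, ht, rfl⟩
  -- Either the loop avoids all the small disks, and `F` measures its whole length, or it enters one
  -- of them.
  by_cases hin : ∀ t, c t ∈ K₁
  · have hγU (z : UnitAddCircle) : (γ z : M) ∈ (P : Set M)ᶜ := by
      obtain ⟨t, -, h⟩ := hcγ z
      exact h ▸ hK₁U (hin t)
    let γ' : C(UnitAddCircle, ((P : Set M)ᶜ : Set M)) := ⟨fun z => ⟨γ z, hγU z⟩, by fun_prop⟩
    let i : C(((P : Set M)ᶜ : Set M), (univ : Set M)) := ⟨fun z => ⟨z, trivial⟩, by fun_prop⟩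
    have hγ' : γ = i.comp γ' := rfl
    have hadm : IsAdmissible P γ' := by
      refine ⟨fun h => hγ.2 (hγ' ▸ h.comp_right i), fun x _ δ hδ h => hγ.2 ?_⟩
      obtain ⟨y, hy⟩ := hδ.nullhomotopic i fun _ => rfl
      exact ⟨y, hγ' ▸ ((ContinuousMap.Homotopic.refl i).comp h).trans hy⟩
    have h1 : markedSystole P F ≤ length F c := iInf₂_le γ' ⟨hγ.1, hadm⟩
    have h2 : length F c ≤ length F' c := hle fun t _ => hin t
    exact (h1.trans h2).not_gt (hlt.trans hL)
  · simp only [hK₁, mem_ofPred_eq, not_forall, not_le] at hin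
    obtain ⟨u₀, x, hx, hu₀⟩ := hin
    obtain ⟨u, hu, hu'⟩ := hcγ (u₀ : UnitAddCircle)
    replace hu' : ρ x (c u) < r (k x) := by rw [hu']; exact hu₀
    -- Otherwise the loop would stay within `R < ε` of `x` and be contractible.
    obtain ⟨w, hw, hw'⟩ : ∃ w ∈ Ico (0 : ℝ) 1, R ≤ ρ x (c w) := by
      by_contra! h
      refine hγ.2 (hnull x γ fun z => ?_)
      obtain ⟨t, ht, htz⟩ := hcγ z
      rw [← htz]
      exact (h t ht).trans hRε
    -- The annulus around `x` avoids the small disks of the other punctures, because its points are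
    -- at distance at least `R` from these.
    have hmem (a b : ℝ) (h : ∀ t ∈ Icc a b, r (k x) ≤ ρ x (c t) ∧ ρ x (c t) ≤ R) :
        ∀ t ∈ Icc a b, c t ∈ K₁ := by
      intro t ht z hz
      rcases eq_or_ne z x with rfl | hzx
      · exact (h t ht).1
      · exact (hrR _).trans (hfar x (c t) z hx hz hzx (h t ht).2)
    -- The loop is cut open at time `s`, so that the other chosen point comes after it within one
    -- period.
    have hlift (s t : ℝ) (hs : s ∈ Ico (0 : ℝ) 1) (ht : t ∈ Ico (0 : ℝ) 1) :
        ∃ t' ∈ Icc s (s + 1), c t' = c t := by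
      rcases le_total s t with h | h
      · exact ⟨t, ⟨h, by linarith [ht.2, hs.1]⟩, rfl⟩
      · exact ⟨t + 1, ⟨by linarith [hs.2, ht.1], by linarith⟩, hper t⟩
    have hcon {s a b : ℝ} (hs : s ∈ Ico (0 : ℝ) 1) (hsa : s ≤ a) (hab : a ≤ b) (hbs : b ≤ s + 1)
        (h : ∀ t ∈ Icc a b, r (k x) ≤ ρ x (c t) ∧ ρ x (c t) ≤ R)
        (hd : L ≤ finslerDist (P : Set M)ᶜ F (c a) (c b)) : False := by
      have hK := hmem a b h
      have h1 := finslerDist_le_lengthOn hF hab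
        ((hcs.periodic hper ⟨hs.1, hs.2.le⟩).restrict hsa hab hbs) fun t ht => hK₁U (hK t ht)
      have h2 := lengthOn_periodic F' hper ⟨hs.1, hs.2.le⟩
      exact (((hd.trans h1).trans (hle hK)).trans ((lengthOn_mono_interval hsa hbs).trans
        h2.le)).not_gt hlt
    have hcont {s : ℝ} (hs : s ∈ Ico (0 : ℝ) 1) :
        ContinuousOn (fun t => ρ x (c t)) (Icc s (s + 1)) :=
      (hρc x).comp_continuousOn (hcs.periodic hper ⟨hs.1, hs.2.le⟩).continuousOn
    -- For an inward wall the loop is cut at its far point `w`, for an outward wall at its near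
    -- point `u`. The outward crossing is found by negating `ρ`.
    rcases hk x hx with hfwd | hbwd
    · obtain ⟨u', hu'', hcu⟩ := hlift w u hw hu
      obtain ⟨a, b, hwa, hab, hbu, ha, hb, h⟩ := exists_crossing hu''.1
        ((hcont hw).mono (Icc_subset_Icc le_rfl hu''.2)) hw' (by rw [hcu]; exact hu'.le) (hrR (k x))
      exact hcon hw hwa hab (hbu.trans hu''.2) h (hfwd _ _ ha hb)
    · obtain ⟨w', hw'', hcw⟩ := hlift u w hu hw
      obtain ⟨a, b, hua, hab, hbw, ha, hb, h⟩ := exists_crossing (R := -r (k x)) (r := -R) hw''.1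
        ((hcont hu).mono (Icc_subset_Icc le_rfl hw''.2)).neg (neg_le_neg hu'.le)
        (by simpa only [Pi.neg_apply, hcw] using neg_le_neg hw') (neg_le_neg (hrR (k x)))
      refine hcon hu hua hab (hbw.trans hw''.2) (fun t ht => ?_)
        (hbwd _ _ (neg_injective hb) (neg_injective ha))
      exact ⟨neg_le_neg_iff.1 (h t ht).2, neg_le_neg_iff.1 (h t ht).1⟩

end Systole

/-! ### Area of the cut-off metric -/

section Comparison

variable [IsManifold (𝓡 2) ∞ M] {F G : TangentBundle (𝓡 2) M → ℝ} {U V : Set M}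

theorem IsContinuousFinslerMetric.mono (hF : IsContinuousFinslerMetric V F) (h : U ⊆ V) :
    IsContinuousFinslerMetric U F where
  continuousOn := hF.continuousOn.mono fun _ hv => h hv
  subadditive x hx := hF.subadditive x (h hx)
  homogeneous x hx := hF.homogeneous x (h hx)
  pos x hx := hF.pos x (h hx)

/-- On `K` the bounds `χ ≤ 1` and `G ≤ C F` give a square at most `(1 + (δ C)²) F²`; off `K` only `δ
G` remains. Area scales as the square of the metric. -/
theorem area_cutoffMetric_le [MeasurableSpace M] [BorelSpace M] {χ : M → ℝ} {K : Set M}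
    (hF : IsContinuousFinslerMetric U F) (hG : IsContinuousFinslerMetric univ G) (hU : IsOpen U)
    (hχ : ∀ x, 0 ≤ χ x ∧ χ x ≤ 1) (hK : IsClosed K) (hKU : K ⊆ U) (hχK : ∀ x ∉ K, χ x = 0)
    {C : ℝ} (hGF : ∀ z ∈ K, ∀ v : TangentSpace (𝓡 2) z, G ⟨z, v⟩ ≤ C * F ⟨z, v⟩)
    {δ : ℝ} (hδ : 0 < δ) :
    area univ (cutoffMetric χ δ F G) ≤
      ENNReal.ofReal (1 + (δ * C) ^ 2) * area U F + ENNReal.ofReal (δ ^ 2) * area univ G := by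
  have hpos : 0 < 1 + (δ * C) ^ 2 := by positivity
  rw [← Real.sq_sqrt hpos.le]
  refine area_le_of_le hU hK.measurableSet hKU (Real.sqrt_pos.2 hpos) hδ (fun z hz v => ?_)
    fun z hz v => ?_
  · have hFz := hF.nonneg (hKU hz) v
    have hGz := hG.nonneg (mem_univ z) v
    refine Real.sqrt_le_iff.2 ⟨by positivity, ?_⟩
    rw [mul_pow (√_), Real.sq_sqrt hpos.le]
    have h1 : (χ z * F ⟨z, v⟩) ^ 2 ≤ F ⟨z, v⟩ ^ 2 :=
      pow_le_pow_left₀ (mul_nonneg (hχ z).1 hFz) (mul_le_of_le_one_left hFz (hχ z).2) 2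
    have h2 : (δ * G ⟨z, v⟩) ^ 2 ≤ (δ * (C * F ⟨z, v⟩)) ^ 2 :=
      pow_le_pow_left₀ (by positivity) (mul_le_mul_of_nonneg_left (hGF z hz v) hδ.le) 2
    calc _ ≤ F ⟨z, v⟩ ^ 2 + (δ * (C * F ⟨z, v⟩)) ^ 2 := add_le_add h1 h2
      _ = _ := by ring
  · simp only [cutoffMetric, hχK z hz, zero_mul]
    rw [zero_pow two_ne_zero, zero_add, Real.sqrt_sq (mul_nonneg hδ.le (hG.nonneg (mem_univ z) v))]

theorem compl_finset_nonempty {M : Type*} [TopologicalSpace M] [ChartedSpace Plane M] [Nonempty M]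
    (P : Finset M) : (P : Set M)ᶜ.Nonempty := by
  obtain ⟨x⟩ := ‹Nonempty M›
  rw [nonempty_compl]
  intro h
  have hfin : (chartAt Plane x).source.Finite := P.finite_toSet.subset (h ▸ subset_univ _)
  have := hfin.image (chartAt Plane x)
  rw [(chartAt Plane x).image_source_eq_target] at this
  exact infinite_of_mem_nhds _ ((chartAt Plane x).open_target.mem_nhds (mem_chart_target Plane x))
    this

end Comparison

/-- The marked systole of a complete punctured surface is controlled by the systolic ratio of an
extremal metric on the closed surface. -/
theorem markedSystole_le {M : Type*} [TopologicalSpace M] [T2Space M] [CompactSpace M]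
    [ConnectedSpace M] [ChartedSpace Plane M] [IsManifold (𝓡 2) ∞ M]
    [MeasurableSpace M] [BorelSpace M]
    (κ : MetricKind) (F₀ : TangentBundle (𝓡 2) M → ℝ)
    (hF₀ : IsSystolicallyExtremal κ F₀)
    (P : Finset M) (F : TangentBundle (𝓡 2) M → ℝ)
    (hF : IsFinslerMetric (P : Set M)ᶜ F) (hκ : κ.Holds (P : Set M)ᶜ F)
    (hcomplete : IsForwardComplete (P : Set M)ᶜ F ∨
      IsBackwardComplete (P : Set M)ᶜ F) :
    markedSystole P F ≤
      systolicRatio F₀ * area (P : Set M)ᶜ F ^ (1 / 2 : ℝ) := by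
  obtain ⟨n, e, he, hemb, hinj⟩ := exists_embedding_euclidean_of_compact (I := 𝓡 2) (M := M)
  set G := inducedMetric e
  have hG : IsFinslerMetric univ G := isFinslerMetric_inducedMetric he hinj
  have hGa : area univ G ≠ ⊤ := (area_lt_top hG.toIsContinuousFinslerMetric).ne
  have hU : IsOpen (P : Set M)ᶜ := P.finite_toSet.isClosed.isOpen_compl
  have hFc := hF.toIsContinuousFinslerMetric
  set A := area (P : Set M)ᶜ F with hA
  have hApos : 0 < A := area_pos hFc hU (compl_finset_nonempty P)
  -- Since `0 * ⊤ = 0`, this is what makes the bound trivial when the area is infinite. The metric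
  -- `G` has positive systole and finite area.
  have hc0 : 0 < systolicRatio F₀ :=
    (ENNReal.div_pos (systole_inducedMetric_pos he hemb).ne'
      (ENNReal.rpow_ne_top_of_nonneg (by norm_num) hGa)).trans_le
      (hF₀.le_ratio G hG (holds_inducedMetric κ))
  by_cases hAtop : A = ⊤
  · rw [hAtop, ENNReal.top_rpow_of_pos (by norm_num), ENNReal.mul_top hc0.ne']
    exact le_top
  -- This happens when `M` is simply connected, the systole being an infimum over the empty set.
  by_cases hctop : systolicRatio F₀ = ⊤
  · rw [hctop, ENNReal.top_mul (ENNReal.rpow_pos hApos hAtop).ne']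
    exact le_top
  refine le_of_forall_lt_imp_le_of_dense fun L hL => ?_
  obtain ⟨χ, K, hχ, hχ01, hK, hKP, hχK, hsys⟩ :=
    exists_cutoff_le_systole he hemb hFc hcomplete hL
  -- `C` depends on `K`, hence on `L`, but not on δ, so δ can tend to 0 afterwards.
  obtain ⟨C, -, hGF⟩ := exists_le_mul_of_isCompact
    (hG.toIsContinuousFinslerMetric.mono (subset_univ _)) hFc hU hK.isCompact hKP
  have hχ0 : ∀ x ∉ (P : Set M)ᶜ, ∀ᶠ y in 𝓝 x, χ y = 0 := fun x hx => by
    filter_upwards [hK.isOpen_compl.mem_nhds fun h => hx (hKP h)] with y hy using hχK y hy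
  have hbound (δ : ℝ) (hδ : 0 < δ) : L ≤ systolicRatio F₀ *
      (ENNReal.ofReal (1 + (δ * C) ^ 2) * A + ENNReal.ofReal (δ ^ 2) * area univ G) ^
        (1 / 2 : ℝ) := by
    have hF' := isFinslerMetric_cutoffMetric hF hG hU hχ (fun x => (hχ01 x).1) hχ0 hδ
    have hratio := hF₀.le_ratio _ hF' (holds_cutoffMetric hκ (holds_inducedMetric κ)
      fun x hx => (hχ0 x hx).self_of_nhds)
    have hpos := area_pos hF'.toIsContinuousFinslerMetric isOpen_univ univ_nonempty
    have htop := area_lt_top hF'.toIsContinuousFinslerMetric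
    rw [systolicRatio, ENNReal.div_le_iff (ENNReal.rpow_pos hpos htop.ne).ne'
      (ENNReal.rpow_ne_top_of_nonneg (by norm_num) htop.ne)] at hratio
    refine ((hsys _ fun x hx v => le_cutoffMetric hx v).trans hratio).trans ?_
    gcongr
    exact area_cutoffMetric_le hFc hG.toIsContinuousFinslerMetric hU hχ01 hK hKP hχK hGF hδ
  have hlim : Tendsto (fun δ : ℝ => systolicRatio F₀ *
      (ENNReal.ofReal (1 + (δ * C) ^ 2) * A + ENNReal.ofReal (δ ^ 2) * area univ G) ^
        (1 / 2 : ℝ)) (𝓝[>] 0) (𝓝 (systolicRatio F₀ * A ^ (1 / 2 : ℝ))) := by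
    have h1 : Tendsto (fun δ : ℝ => ENNReal.ofReal (1 + (δ * C) ^ 2)) (𝓝[>] 0) (𝓝 1) := by
      have : Continuous fun δ : ℝ => ENNReal.ofReal (1 + (δ * C) ^ 2) :=
        ENNReal.continuous_ofReal.comp (by fun_prop)
      simpa using (this.tendsto 0).mono_left nhdsWithin_le_nhds
    have h2 : Tendsto (fun δ : ℝ => ENNReal.ofReal (δ ^ 2)) (𝓝[>] 0) (𝓝 0) := by
      have : Continuous fun δ : ℝ => ENNReal.ofReal (δ ^ 2) :=
        ENNReal.continuous_ofReal.comp (by fun_prop)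
      simpa using (this.tendsto 0).mono_left nhdsWithin_le_nhds
    have h3 := (ENNReal.Tendsto.mul_const h1 (Or.inr hAtop)).add
      (ENNReal.Tendsto.mul_const h2 (Or.inr hGa))
    rw [one_mul, zero_mul, add_zero] at h3
    exact ENNReal.Tendsto.const_mul ((ENNReal.continuous_rpow_const.tendsto A).comp h3)
      (Or.inr hctop)
  exact ge_of_tendsto hlim (by filter_upwards [self_mem_nhdsWithin] with δ hδ using hbound δ hδ)

end SystolicSurface

end

theorem proposition5p1 {M : Type*} [TopologicalSpace M] [T2Space M] [CompactSpace M]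
    [ConnectedSpace M] [ChartedSpace SystolicSurface.Plane M] [IsManifold (𝓡 2) ∞ M]
    [MeasurableSpace M] [BorelSpace M]
    (κ : SystolicSurface.MetricKind) (F₀ : TangentBundle (𝓡 2) M → ℝ)
    (hF₀ : SystolicSurface.IsSystolicallyExtremal κ F₀)
    (P : Finset M) (F : TangentBundle (𝓡 2) M → ℝ)
    (hF : SystolicSurface.IsFinslerMetric (P : Set M)ᶜ F) (hκ : κ.Holds (P : Set M)ᶜ F)
    (hcomplete : SystolicSurface.IsForwardComplete (P : Set M)ᶜ F ∨
      SystolicSurface.IsBackwardComplete (P : Set M)ᶜ F) :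
    SystolicSurface.markedSystole P F ≤
      SystolicSurface.systolicRatio F₀ * SystolicSurface.area (P : Set M)ᶜ F ^ (1 / 2 : ℝ) :=
  SystolicSurface.markedSystole_le κ F₀ hF₀ P F hF hκ hcomplete
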